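/- Let $(M,g)$ be a compact Riemannian manifold (smooth, Hausdorff, finite-dimensional, without boundary) with Levi-Civita connection $\hat\nabla$, and let $\sigma:M\to\mathbb R$ be a smooth function. Put $A=\mathrm{sym}(d\sigma\otimes g)$, that is, $$A(X,Y,Z)=\tfrac13\big(d\sigma(X)\,g(Y,Z)+d\sigma(Y)\,g(X,Z)+d\sigma(Z)\,g(X,Y)\big).$$ There is a connection $\nabla$ on $M$ with cubic form $A$, i.e. $g(\nabla_XY-\hat\nabla_XY,Z)=A(X,Y,Z)$ for all vector fields $X,Y,Z$. Moreover, for this connection: 1. $(g,\nabla)$ is a statistical structure: $\nabla$ is smooth and torsion-free, and $\nabla g$ is symmetric in all three arguments. 2. $\nabla$ is complete. 3. The dual connection $\overline\nabla$, defined by $X\,g(Y,Z)=g(\nabla_XY,Z)+g(Y,\overline\nabla_XZ)$, exists and is complete. Here a connection is called complete if every geodesic of it (with affine parameter), given on an open interval, extends to a geodesic defined on all of $\mathbb R$. -/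

import Mathlib

open Bundle
open scoped Manifold ContDiff

noncomputable section

namespace StatisticalManifold

section

variable {E : Type*} [NormedAddCommGroup E] [NormedSpace ℝ E] [FiniteDimensional ℝ E]
  {H : Type*} [TopologicalSpace H] {I : ModelWithCorners ℝ E H}
  {M : Type*} [TopologicalSpace M] [ChartedSpace H M]

/-- The velocity `γ'(t)` of a curve `γ` in a manifold. -/
def velocity (I : ModelWithCorners ℝ E H) (γ : ℝ → M) (t : ℝ) : TangentSpace I (γ t) :=
  mfderiv 𝓘(ℝ) I γ t (1 : ℝ)

variable [IsManifold I ∞ M]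

/-- An affine connection `∇` on `M`: a covariant derivative on the tangent bundle, where
`nabla Y x u` is `∇_u Y` for a vector field `Y` and a tangent vector `u` at `x`.  Its values on
vector fields that are not differentiable at `x` carry no meaning and are never used. -/
abbrev Connection (I : ModelWithCorners ℝ E H) (M : Type*) [TopologicalSpace M]
    [ChartedSpace H M] [IsManifold I ∞ M] :=
  CovariantDerivative I E (fun x : M ↦ TangentSpace I x)

/-- `∇` is torsion-free. -/
def IsTorsionFree (nabla : Connection I M) : Prop :=
  haveI : CompleteSpace E := FiniteDimensional.complete ℝ E
  nabla.torsion = 0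

/-- The covariant derivative at time `t`, induced by `∇`, of a vector field `Y` along a curve `γ`.
If `∂ᵢ` are the coordinate fields of the chart at `γ t` and `Y = ∑ Yⁱ ∂ᵢ` along `γ`, this
is `∑ (Yⁱ)'(t) ∂ᵢ + ∑ Yⁱ(t) ∇_{γ'(t)} ∂ᵢ`; here `FiberBundle.extend E (Y t)` is the vector field
`∑ Yⁱ(t) ∂ᵢ` near `γ t`, with constant components. -/
def covDerivAlong (nabla : Connection I M) (γ : ℝ → M)
    (Y : ∀ t, TangentSpace I (γ t)) (t : ℝ) : TangentSpace I (γ t) :=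
  (trivializationAt E (TangentSpace I : M → Type _) (γ t)).symm (γ t)
      (deriv (fun s ↦ (trivializationAt E (TangentSpace I : M → Type _) (γ t)
        (⟨γ s, Y s⟩ : TangentBundle I M)).2) t)
    + nabla (FiberBundle.extend E (Y t)) (γ t) (velocity I γ t)

/-- `γ` is, on the open set `s` of parameters, a geodesic of `∇` with affine parameter:
`∇_{γ'} γ' = 0` on `s`. -/
def IsGeodesicOn (nabla : Connection I M) (γ : ℝ → M) (s : Set ℝ) : Prop :=
  ContMDiffOn 𝓘(ℝ) I 2 γ s ∧
    ∀ t ∈ s, covDerivAlong nabla γ (velocity I γ) t = 0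

/-- `∇` is complete: every geodesic, given on an open interval of its affine parameter, extends to
a geodesic defined on all of `ℝ`. -/
def IsComplete (nabla : Connection I M) : Prop :=
  ∀ (s : Set ℝ) (γ : ℝ → M), IsOpen s → s.OrdConnected → s.Nonempty →
    IsGeodesicOn nabla γ s →
      ∃ δ : ℝ → M, IsGeodesicOn nabla δ Set.univ ∧ Set.EqOn δ γ s

variable [RiemannianBundle (fun x : M ↦ TangentSpace I x)]
  [IsContMDiffRiemannianBundle I ∞ E (fun x : M ↦ TangentSpace I x)]

/-- The covariant derivative of the metric, `(∇g)(u, v, w) = (∇_u g)(v, w)`. -/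
def nablaMetric (nabla : Connection I M) (x : M) (u v w : TangentSpace I x) : ℝ :=
  nabla.derivMetricTensor x v w u

/-- `∇` is a Levi-Civita connection of `g`: torsion-free and metric. -/
def IsLeviCivita (nabla : Connection I M) : Prop :=
  IsTorsionFree nabla ∧
    CovariantDerivative.IsMetricCompatible (V := fun x : M ↦ TangentSpace I x) nabla

/-- `(g, ∇)` is a statistical structure: `∇` is a smooth torsion-free connection and `∇g` is
symmetric in all its arguments (symmetry in the last two holds for every connection). -/
structure IsStatistical (nabla : Connection I M) : Prop where
  smooth : CovariantDerivative.ContMDiffCovariantDerivative nabla ∞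
  torsionFree : IsTorsionFree nabla
  symm₁₂ : ∀ (x : M) (u v w : TangentSpace I x),
    nablaMetric nabla x u v w = nablaMetric nabla x v u w
  symm₂₃ : ∀ (x : M) (u v w : TangentSpace I x),
    nablaMetric nabla x u v w = nablaMetric nabla x u w v

/-- The cubic form of `(g, ∇)` is `A`: `A(X, Y, Z) = g(K(X, Y), Z)`, where
`K(X, Y) = ∇_X Y - ∇̂_X Y` and `∇̂` is the Levi-Civita connection of `g`. -/
def HasCubicForm (nabla : Connection I M)
    (A : ∀ x : M, TangentSpace I x → TangentSpace I x → TangentSpace I x → ℝ) : Prop :=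
  ∃ lc : Connection I M, IsLeviCivita lc ∧
    ∀ (x : M) (u v w : TangentSpace I x),
      A x u v w = inner ℝ (nabla.difference lc x v u) w

/-- `∇'` is dual to `∇` with respect to `g`: `X g(Y, Z) = g(∇_X Y, Z) + g(Y, ∇'_X Z)`. -/
def IsDual (nabla nabla' : Connection I M) : Prop :=
  ∀ (x : M) (u : TangentSpace I x) (Y Z : ∀ y : M, TangentSpace I y),
    MDiffAt (T% Y) x → MDiffAt (T% Z) x →
      d% (fun y : M ↦ inner ℝ (Y y) (Z y)) x u
        = inner ℝ (nabla Y x u) (Z x) + inner ℝ (Y x) (nabla' Z x u)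

/-- Symmetrization of a function of three variables. -/
def sym {V : Type*} (T : V → V → V → ℝ) (u v w : V) : ℝ :=
  (T u v w + T u w v + T v u w + T v w u + T w u v + T w v u) / 6

/-- The symmetric cubic form `sym(dσ ⊗ g)`. -/
def symDerivMetric (σ : M → ℝ) (x : M) : TangentSpace I x → TangentSpace I x →
    TangentSpace I x → ℝ :=
  sym fun u v w ↦ d% σ x u * inner ℝ v w

end

end StatisticalManifold

end

/-!
In a chart, Koszul's formula determines the Christoffel symbols of the Levi-Civita connection `∇̂`
and so proves its existence. A connection with cubic form `A` is `∇̂ + K`, where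
`g(K_X Y, Z) = A(X, Y, Z)`; symmetry of `A` makes it torsion-free and gives `∇g = -2A`. For
`A = sym(dσ ⊗ g)` and a geodesic `γ` of `∇` this reads
`d/dt g(γ', γ') = -2 A(γ', γ', γ') = -2 dσ(γ') g(γ', γ')`, so `e^{2σ} g(γ', γ')` is constant
along `γ`. On a compact manifold `σ` is bounded, hence so is the speed of `γ`, and geodesics of
bounded speed can be continued by a uniform amount of time; therefore `∇` is complete. The dual
connection has cubic form `-A`, which is the form belonging to `-σ`.
-/

noncomputable section

namespace StatisticalManifold

section Coordinates

variable {E : Type*} [NormedAddCommGroup E] [NormedSpace ℝ E]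
  {H : Type*} [TopologicalSpace H] {I : ModelWithCorners ℝ E H}
  {M : Type*} [TopologicalSpace M] [ChartedSpace H M] {p q x : M}

lemma extChartAt_mem_target (hx : x ∈ (chartAt H p).source) :
    extChartAt I p x ∈ (extChartAt I p).target :=
  (extChartAt I p).map_source (by rwa [extChartAt_source])

lemma extChartAt_symm_mem_source {y : E} (hy : y ∈ (extChartAt I p).target) :
    (extChartAt I p).symm y ∈ (chartAt H p).source := by
  rw [← extChartAt_source I]
  exact (extChartAt I p).map_target hy

lemma extChartAt_symm_extChartAt (hx : x ∈ (chartAt H p).source) :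
    (extChartAt I p).symm (extChartAt I p x) = x :=
  (extChartAt I p).left_inv (by rwa [extChartAt_source])

lemma chart_source_mem_nhds (hx : x ∈ (chartAt H p).source) : (chartAt H p).source ∈ nhds x :=
  (chartAt H p).open_source.mem_nhds hx

variable [IsManifold I ∞ M]

lemma mem_baseSet_trivializationAt_iff :
    x ∈ (trivializationAt E (TangentSpace I : M → Type _) p).baseSet ↔
      x ∈ (chartAt H p).source := Iff.rfl

variable (I) in
/-- The components of a tangent vector at `x` in the chart at `p`; this is `0` if `x` does not lie
in the domain of the chart. -/
def coord (p x : M) : TangentSpace I x →L[ℝ] E :=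
  (trivializationAt E (TangentSpace I : M → Type _) p).continuousLinearMapAt ℝ x

variable (I) in
/-- The tangent vector at `x` with given components in the chart at `p`; this is `0` if `x` does
not lie in the domain of the chart. -/
def ofCoord (p x : M) : E →L[ℝ] TangentSpace I x :=
  (trivializationAt E (TangentSpace I : M → Type _) p).symmL ℝ x

variable (I) in
/-- The vector field `∑ aⁱ ∂ᵢ` with constant components `a` in the chart at `p`. -/
def coordField (p : M) (a : E) (x : M) : TangentSpace I x :=
  (trivializationAt E (TangentSpace I : M → Type _) p).symm x a

variable (I) in
/-- The transition map at `x` from components in the chart at `p` to components in the chart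
at `q`. -/
def coordChange (p q x : M) : E →L[ℝ] E :=
  coord I q x ∘L ofCoord I p x

lemma coord_apply (hx : x ∈ (chartAt H p).source) (u : TangentSpace I x) :
    coord I p x u =
      (trivializationAt E (TangentSpace I : M → Type _) p (⟨x, u⟩ : TangentBundle I M)).2 := by
  rw [coord, Trivialization.continuousLinearMapAt_apply,
    Trivialization.coe_linearMapAt_of_mem _ (mem_baseSet_trivializationAt_iff.2 hx)]

lemma coord_eq_mfderiv (hx : x ∈ (chartAt H p).source) :
    coord I p x = mfderiv I 𝓘(ℝ, E) (extChartAt I p) x :=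
  TangentBundle.continuousLinearMapAt_trivializationAt hx

lemma coord_ofCoord (hx : x ∈ (chartAt H p).source) (a : E) :
    coord I p x (ofCoord I p x a) = a :=
  Trivialization.continuousLinearMapAt_symmL _ (mem_baseSet_trivializationAt_iff.2 hx) a

lemma ofCoord_coord (hx : x ∈ (chartAt H p).source) (u : TangentSpace I x) :
    ofCoord I p x (coord I p x u) = u :=
  Trivialization.symmL_continuousLinearMapAt _ (mem_baseSet_trivializationAt_iff.2 hx) u

lemma coord_injective (hx : x ∈ (chartAt H p).source) : Function.Injective (coord I p x) :=
  Function.LeftInverse.injective (ofCoord_coord hx)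

lemma coordField_apply (hx : x ∈ (chartAt H p).source) (a : E) :
    coordField I p a x = ofCoord I p x a :=
  (Trivialization.symmL_apply _ (mem_baseSet_trivializationAt_iff.2 hx) a).symm

lemma coord_coordField (hx : x ∈ (chartAt H p).source) (a : E) :
    coord I p x (coordField I p a x) = a := by
  rw [coordField_apply hx, coord_ofCoord hx]

lemma coord_coordField_eventuallyEq (hx : x ∈ (chartAt H p).source) (a : E) :
    (fun y ↦ coord I p y (coordField I p a y)) =ᶠ[nhds x] fun _ ↦ a := by
  filter_upwards [chart_source_mem_nhds hx] with y hy using coord_coordField hy a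

lemma coordField_coord (hx : x ∈ (chartAt H p).source) (u : TangentSpace I x) :
    coordField I p (coord I p x u) x = u := by
  rw [coordField_apply hx, ofCoord_coord hx]

lemma extend_eq_coordField (u : TangentSpace I x) :
    FiberBundle.extend E u = coordField I x (coord I x x u) := by
  funext y
  rw [coordField, coord_apply (mem_chart_source H x), FiberBundle.extend]

lemma coord_eq_coordChange (hp : x ∈ (chartAt H p).source) (u : TangentSpace I x) :
    coord I q x u = coordChange I p q x (coord I p x u) := by
  rw [coordChange, ContinuousLinearMap.comp_apply, ofCoord_coord hp]

lemma contMDiffAt_coordChange (hp : x ∈ (chartAt H p).source) (hq : x ∈ (chartAt H q).source) :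
    CMDiffAt ∞ (coordChange I p q) x := by
  have hL := contMDiffAt_coordChangeL (IB := I) (n := ∞)
    (mem_baseSet_trivializationAt_iff (I := I).2 hp)
    (mem_baseSet_trivializationAt_iff (I := I).2 hq)
  refine hL.congr_of_eventuallyEq ?_
  filter_upwards [chart_source_mem_nhds hp, chart_source_mem_nhds hq] with y hyp hyq
  ext a
  rw [coordChange, ContinuousLinearMap.comp_apply, coord_apply hyq, ofCoord,
    Trivialization.symmL_apply _ (mem_baseSet_trivializationAt_iff.2 hyp)]
  exact (Trivialization.coordChangeL_apply _ _ ⟨hyp, hyq⟩ a).symm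

lemma coord_section_eventuallyEq (hx : x ∈ (chartAt H p).source)
    (Y : ∀ y : M, TangentSpace I y) :
    (fun y ↦ coord I p y (Y y)) =ᶠ[nhds x] fun y ↦
      (trivializationAt E (TangentSpace I : M → Type _) p (⟨y, Y y⟩ : TangentBundle I M)).2 := by
  filter_upwards [chart_source_mem_nhds hx] with y hy using coord_apply hy _

lemma contMDiffAt_section_iff_coord (hx : x ∈ (chartAt H p).source)
    (Y : ∀ y : M, TangentSpace I y) :
    CMDiffAt ∞ (T% Y) x ↔ CMDiffAt ∞ (fun y ↦ coord I p y (Y y)) x := by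
  rw [(coord_section_eventuallyEq hx Y).contMDiffAt_iff]
  exact Trivialization.contMDiffAt_section_iff _ (mem_baseSet_trivializationAt_iff.2 hx)

lemma mdifferentiableAt_section_iff_coord (hx : x ∈ (chartAt H p).source)
    (Y : ∀ y : M, TangentSpace I y) :
    MDiffAt (T% Y) x ↔ MDiffAt (fun y ↦ coord I p y (Y y)) x := by
  rw [(coord_section_eventuallyEq hx Y).mdifferentiableAt_iff]
  exact Trivialization.mdifferentiableAt_section_iff I _ _ (mem_baseSet_trivializationAt_iff.2 hx)

lemma contMDiffAt_coordField (hx : x ∈ (chartAt H p).source) (a : E) :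
    CMDiffAt ∞ (T% (coordField I p a)) x := by
  rw [contMDiffAt_section_iff_coord hx]
  exact contMDiffAt_const.congr_of_eventuallyEq (coord_coordField_eventuallyEq hx a)

lemma mdifferentiableAt_coordField (hx : x ∈ (chartAt H p).source) (a : E) :
    MDiffAt (T% (coordField I p a)) x :=
  (contMDiffAt_coordField hx a).mdifferentiableAt (by simp)

/-- The constant vector field `a` on the model space `E`. -/
def constField (a y : E) : TangentSpace 𝓘(ℝ, E) y := a

lemma mdifferentiableAt_constField (a y : E) : MDiffAt (T% (constField a)) y := by
  refine ContMDiffAt.mdifferentiableAt (n := 1) ?_ one_ne_zero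
  rw [contMDiffAt_vectorSpace_iff_contDiffAt]
  exact contDiffAt_const

lemma mlieBracket_constField (a b y : E) :
    VectorField.mlieBracket 𝓘(ℝ, E) (constField a) (constField b) y = 0 := by
  have hlie : VectorField.lieBracketWithin ℝ (fun _ ↦ a) (fun _ ↦ b) Set.univ y = 0 := by
    simp [VectorField.lieBracketWithin]
  rw [← VectorField.mlieBracketWithin_univ, VectorField.mlieBracketWithin_eq_lieBracketWithin]
  exact hlie

lemma coordField_eventuallyEq_mpullback (hx : x ∈ (chartAt H p).source) (a : E) :
    coordField I p a =ᶠ[nhds x]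
      VectorField.mpullback I 𝓘(ℝ, E) (extChartAt I p) (constField a) := by
  filter_upwards [chart_source_mem_nhds hx] with y hy
  obtain ⟨L, hL⟩ := isInvertible_mfderiv_extChartAt (I := I) (x := p) (y := y)
    (by rwa [extChartAt_source])
  rw [VectorField.mpullback_apply, ← hL, ContinuousLinearMap.inverse_equiv]
  apply L.injective
  rw [ContinuousLinearEquiv.coe_coe, ContinuousLinearEquiv.apply_symm_apply,
    ← ContinuousLinearEquiv.coe_coe, hL, ← coord_eq_mfderiv hy]
  exact coord_coordField hy a

lemma mlieBracket_coordField [CompleteSpace E] (hx : x ∈ (chartAt H p).source) (a b : E) :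
    VectorField.mlieBracket I (coordField I p a) (coordField I p b) x = 0 := by
  have hM : IsManifold I (minSmoothness ℝ 3) M := by
    rw [minSmoothness_of_isRCLikeNormedField]
    infer_instance
  rw [(coordField_eventuallyEq_mpullback hx a).mlieBracket_vectorField_eq
      (coordField_eventuallyEq_mpullback hx b),
    ← VectorField.mpullback_mlieBracket (n := 2) (mdifferentiableAt_constField _ _)
      (mdifferentiableAt_constField _ _) (contMDiffAt_extChartAt' hx) (by simp),
    VectorField.mpullback_apply, mlieBracket_constField, map_zero]

variable {F : Type*} [NormedAddCommGroup F] [NormedSpace ℝ F] {f : M → F}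

lemma contDiffAt_comp_extChartAt_symm [I.Boundaryless] {y : E} (hy : y ∈ (extChartAt I p).target)
    (hf : CMDiffAt ∞ f ((extChartAt I p).symm y)) :
    ContDiffAt ℝ ∞ (f ∘ (extChartAt I p).symm) y := by
  rw [← contMDiffAt_iff_contDiffAt]
  exact hf.comp y ((contMDiffOn_extChartAt_symm p).contMDiffAt
    ((isOpen_extChartAt_target p).mem_nhds hy))

lemma mvfderiv_eq_fderiv_comp_coord [I.Boundaryless] (hx : x ∈ (chartAt H p).source)
    (hf : MDiffAt f x) :
    d% f x = fderiv ℝ (f ∘ (extChartAt I p).symm) (extChartAt I p x) ∘L coord I p x := by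
  have hsymm : MDiffAt (extChartAt I p).symm (extChartAt I p x) :=
    ((contMDiffOn_extChartAt_symm (n := 1) p).contMDiffAt
      ((isOpen_extChartAt_target p).mem_nhds (extChartAt_mem_target hx))).mdifferentiableAt
      one_ne_zero
  have hcomp : MDiffAt (f ∘ (extChartAt I p).symm) (extChartAt I p x) :=
    MDifferentiableAt.comp _ (by rwa [extChartAt_symm_extChartAt hx]) hsymm
  have heq : f =ᶠ[nhds x] (f ∘ (extChartAt I p).symm) ∘ extChartAt I p := by
    filter_upwards [chart_source_mem_nhds hx] with y hy
    rw [Function.comp_apply, Function.comp_apply, extChartAt_symm_extChartAt hy]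
  rw [coord_eq_mfderiv hx, mvfderiv, heq.mfderiv_eq,
    mfderiv_comp x hcomp (mdifferentiableAt_extChartAt hx), mfderiv_eq_fderiv]
  rfl

end Coordinates

section BilinearForm

variable {E : Type*} [NormedAddCommGroup E] [NormedSpace ℝ E]

lemma fderiv_bilinear_apply {G : E → E →L[ℝ] E →L[ℝ] ℝ} {y : E} (hG : DifferentiableAt ℝ G y)
    (a b c : E) : fderiv ℝ G y a b c = fderiv ℝ (fun z ↦ G z b c) y a := by
  rw [((hG.hasFDerivAt.clm_apply (hasFDerivAt_const b y)).clm_apply (hasFDerivAt_const c y)).fderiv]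
  simp

variable [FiniteDimensional ℝ E]

lemma exists_continuousLinearEquiv_eq {G : E →L[ℝ] E →L[ℝ] ℝ} (hG : Function.Injective G) :
    ∃ L : E ≃L[ℝ] (E →L[ℝ] ℝ), (L : E →L[ℝ] E →L[ℝ] ℝ) = G := by
  have hdim : Module.finrank ℝ E = Module.finrank ℝ (E →L[ℝ] ℝ) := by
    rw [← (LinearMap.toContinuousLinearMap (𝕜 := ℝ) (E := E) (F' := ℝ)).finrank_eq]
    exact Subspace.dual_finrank_eq.symm
  exact ⟨(LinearMap.linearEquivOfInjective (G : E →ₗ[ℝ] E →L[ℝ] ℝ) hG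
    hdim).toContinuousLinearEquiv, by ext; rfl⟩

lemma exists_bilinear_eq_of_injective {G : E →L[ℝ] E →L[ℝ] ℝ} (hG : Function.Injective G)
    (F : E →L[ℝ] E →L[ℝ] E →L[ℝ] ℝ) :
    ∃ B : E →L[ℝ] E →L[ℝ] E, ∀ a b, G (B a b) = F a b := by
  obtain ⟨L, rfl⟩ := exists_continuousLinearEquiv_eq hG
  exact ⟨(ContinuousLinearMap.compL ℝ E (E →L[ℝ] ℝ) E (L.symm : (E →L[ℝ] ℝ) →L[ℝ] E)) ∘L F,
    fun a b ↦ L.apply_symm_apply (F a b)⟩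

/-- This is the algebra behind the Koszul formula. -/
lemma exists_symm_bilinear_of_deriv {G : E →L[ℝ] E →L[ℝ] ℝ} (hinj : Function.Injective G)
    (hG : ∀ a b, G a b = G b a) (D : E →L[ℝ] E →L[ℝ] E →L[ℝ] ℝ)
    (hD : ∀ a b c, D a b c = D a c b) :
    ∃ B : E →L[ℝ] E →L[ℝ] E, (∀ a b, B a b = B b a) ∧
      ∀ a b c, D a b c = G (B b a) c + G b (B c a) := by
  obtain ⟨S, hS⟩ := exists_bilinear_eq_of_injective hinj D
  obtain ⟨T, hT⟩ := exists_bilinear_eq_of_injective hinj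
    ((ContinuousLinearMap.flipₗᵢ ℝ E E ℝ).toContinuousLinearEquiv.toContinuousLinearMap ∘L D.flip)
  let B : E →L[ℝ] E →L[ℝ] E := (1 / 2 : ℝ) • (S + S.flip - T)
  have koszul (a b c : E) : G (B a b) c = (1 / 2) * (D a b c + D b a c - D c a b) := by
    have hB : B a b = (1 / 2 : ℝ) • (S a b + S b a - T a b) := rfl
    rw [hB, map_smul, map_sub, map_add, hS, hS, hT]
    rfl
  refine ⟨B, fun a b ↦ hinj (ContinuousLinearMap.ext fun c ↦ ?_), fun a b c ↦ ?_⟩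
  · rw [koszul, koszul, hD c a b]
    ring
  · rw [hG b, koszul, koszul, hD a c b, hD c b a, hD b c a]
    ring

lemma exists_symm_bilinear_of_fderiv {G : E → E →L[ℝ] E →L[ℝ] ℝ} {y : E}
    (hG : DifferentiableAt ℝ G y) (hinj : Function.Injective (G y))
    (hsymm : ∀ z a b, G z a b = G z b a) :
    ∃ B : E →L[ℝ] E →L[ℝ] E, (∀ a b, B a b = B b a) ∧
      ∀ a b c, fderiv ℝ (fun z ↦ G z b c) y a = G y (B b a) c + G y b (B c a) := by
  simp_rw [← fderiv_bilinear_apply hG]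
  let D := fderiv ℝ G y
  have hD (a b c : E) : D a b c = D a c b := by
    simp only [D, fderiv_bilinear_apply hG, hsymm _ b c]
  exact exists_symm_bilinear_of_deriv hinj (hsymm y) D hD

lemma contDiffOn_of_contDiffOn_injective {G : E → E →L[ℝ] E →L[ℝ] ℝ} {s : Set E} (hs : IsOpen s)
    (hG : ContDiffOn ℝ ∞ G s) (hinj : ∀ y ∈ s, Function.Injective (G y)) {f : E → E}
    (hf : ∀ c, ContDiffOn ℝ ∞ (fun y ↦ G y (f y) c) s) : ContDiffOn ℝ ∞ f s := by
  intro y hy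
  have hE : CompleteSpace E := FiniteDimensional.complete ℝ E
  have hinv : ContDiffAt ℝ ∞ (fun z ↦ ContinuousLinearMap.inverse (G z)) y := by
    refine ContDiffAt.comp y (g := ContinuousLinearMap.inverse) ?_
      (hG.contDiffAt (hs.mem_nhds hy))
    obtain ⟨L, hL⟩ := exists_continuousLinearEquiv_eq (hinj y hy)
    rw [← hL]
    exact contDiffAt_map_inverse L
  have hGf : ContDiffAt ℝ ∞ (fun z ↦ G z (f z)) y :=
    (contDiffOn_clm_apply.2 hf).contDiffAt (hs.mem_nhds hy)
  refine ((hinv.clm_apply hGf).congr_of_eventuallyEq ?_).contDiffWithinAt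
  filter_upwards [hs.mem_nhds hy] with z hz
  obtain ⟨L, hL⟩ := exists_continuousLinearEquiv_eq (hinj z hz)
  rw [← hL, ContinuousLinearMap.inverse_equiv]
  exact (L.symm_apply_apply (f z)).symm

end BilinearForm

section Christoffel

variable {E : Type*} [NormedAddCommGroup E] [NormedSpace ℝ E]
  {H : Type*} [TopologicalSpace H] {I : ModelWithCorners ℝ E H}
  {M : Type*} [TopologicalSpace M] [ChartedSpace H M] [IsManifold I ∞ M]
  {p x : M} {Y Z : ∀ x : M, TangentSpace I x}

variable (I) in
/-- The flat covariant derivative in the chart at `p`, for which the fields `coordField p a` are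
parallel. -/
def flatDeriv (p : M) (Y : ∀ x : M, TangentSpace I x) (x : M) :
    TangentSpace I x →L[ℝ] TangentSpace I x :=
  ofCoord I p x ∘L d% (fun y ↦ coord I p y (Y y)) x

lemma flatDeriv_add (hx : x ∈ (chartAt H p).source) (hY : MDiffAt (T% Y) x)
    (hZ : MDiffAt (T% Z) x) :
    flatDeriv I p (Y + Z) x = flatDeriv I p Y x + flatDeriv I p Z x := by
  rw [mdifferentiableAt_section_iff_coord hx] at hY hZ
  have hadd : (fun y ↦ coord I p y ((Y + Z) y)) =
      (fun y ↦ coord I p y (Y y)) + fun y ↦ coord I p y (Z y) := by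
    funext y
    exact map_add _ _ _
  rw [flatDeriv, hadd, mvfderiv_add hY hZ, ContinuousLinearMap.comp_add]
  rfl

lemma flatDeriv_smul (hx : x ∈ (chartAt H p).source) {f : M → ℝ} (hY : MDiffAt (T% Y) x)
    (hf : MDiffAt f x) :
    flatDeriv I p (f • Y) x = f x • flatDeriv I p Y x + (d% f x).smulRight (Y x) := by
  rw [mdifferentiableAt_section_iff_coord hx] at hY
  have hsmul : (fun y ↦ coord I p y ((f • Y) y)) = f • fun y ↦ coord I p y (Y y) := by
    funext y
    exact map_smul _ _ _
  rw [flatDeriv, hsmul, mvfderiv_smul hf hY, flatDeriv]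
  ext u
  simp [ofCoord_coord hx]

lemma isCovariantDerivativeOn_flatDeriv (p : M) :
    IsCovariantDerivativeOn E (flatDeriv I p) (chartAt H p).source where
  add hY hZ hx := flatDeriv_add hx hY hZ
  leibniz hY hf hx := flatDeriv_smul hx hY hf

variable [FiniteDimensional ℝ E]

/-- The difference of a connection and the flat connection of the chart at `p`. -/
def christoffel (nabla : Connection I M) (p x : M) :
    TangentSpace I x →L[ℝ] TangentSpace I x →L[ℝ] TangentSpace I x :=
  nabla.isCovariantDerivativeOn.difference (isCovariantDerivativeOn_flatDeriv p) x

/-- The Christoffel symbols of a connection in the chart at `p`, as functions of the coordinates.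
The first argument is differentiated: `Γ(a, b)` represents `∇_b (coordField p a)`. -/
def christoffelCoord (nabla : Connection I M) (p : M) (y : E) : E →L[ℝ] E →L[ℝ] E :=
  letI x := (extChartAt I p).symm y
  LinearMap.toContinuousBilinearMap <| LinearMap.mk₂ ℝ
    (fun a b ↦ coord I p x (christoffel nabla p x (ofCoord I p x a) (ofCoord I p x b)))
    (by simp) (by simp) (by simp) (by simp)

/-- `∇` is a smooth connection, expressed by its Christoffel symbols in every chart. -/
def HasSmoothChristoffel (nabla : Connection I M) : Prop :=
  ∀ p, ContDiffOn ℝ ∞ (christoffelCoord nabla p) (extChartAt I p).target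

lemma nabla_eq_flatDeriv_add_christoffel (nabla : Connection I M)
    (hx : x ∈ (chartAt H p).source) (hY : MDiffAt (T% Y) x) :
    nabla Y x = flatDeriv I p Y x + christoffel nabla p x (Y x) := by
  rw [christoffel, IsCovariantDerivativeOn.difference_apply _ _ hx hY]
  abel

lemma coord_christoffel (nabla : Connection I M) (hx : x ∈ (chartAt H p).source)
    (u v : TangentSpace I x) :
    coord I p x (christoffel nabla p x u v) =
      christoffelCoord nabla p (extChartAt I p x) (coord I p x u) (coord I p x v) := by
  change _ = coord I p ((extChartAt I p).symm (extChartAt I p x)) (christoffel nabla p _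
    (ofCoord I p _ (coord I p x u)) (ofCoord I p _ (coord I p x v)))
  rw [extChartAt_symm_extChartAt hx, ofCoord_coord hx, ofCoord_coord hx]

lemma coord_nabla (nabla : Connection I M) (hx : x ∈ (chartAt H p).source)
    (hY : MDiffAt (T% Y) x) (u : TangentSpace I x) :
    coord I p x (nabla Y x u) = d% (fun y ↦ coord I p y (Y y)) x u +
      christoffelCoord nabla p (extChartAt I p x) (coord I p x (Y x)) (coord I p x u) := by
  rw [nabla_eq_flatDeriv_add_christoffel nabla hx hY, ← coord_christoffel nabla hx]
  simp [flatDeriv, coord_ofCoord hx]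

lemma coord_nabla_coordField (nabla : Connection I M) (hx : x ∈ (chartAt H p).source) (a : E)
    (u : TangentSpace I x) :
    coord I p x (nabla (coordField I p a) x u) =
      christoffelCoord nabla p (extChartAt I p x) a (coord I p x u) := by
  have hconst : d% (fun y ↦ coord I p y (coordField I p a y)) x = 0 := by
    rw [mvfderiv, (coord_coordField_eventuallyEq hx a).mfderiv_eq, mfderiv_const]
    exact ContinuousLinearMap.comp_zero _
  rw [coord_nabla nabla hx (mdifferentiableAt_coordField hx a), coord_coordField hx, hconst,
    zero_apply, zero_add]

lemma IsTorsionFree.christoffelCoord_symm {nabla : Connection I M} (h : IsTorsionFree nabla)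
    {y : E} (hy : y ∈ (extChartAt I p).target) (a b : E) :
    christoffelCoord nabla p y a b = christoffelCoord nabla p y b a := by
  have hE : CompleteSpace E := FiniteDimensional.complete ℝ E
  have hx := extChartAt_symm_mem_source hy
  rw [← (extChartAt I p).right_inv hy]
  set x := (extChartAt I p).symm y
  have htorsion := (CovariantDerivative.torsion_eq_zero_iff nabla).1 h
    (mdifferentiableAt_coordField hx b) (mdifferentiableAt_coordField hx a)
  rw [mlieBracket_coordField hx, sub_eq_zero] at htorsion
  have hcoord := congrArg (coord I p x) htorsion
  rwa [coord_nabla_coordField nabla hx, coord_nabla_coordField nabla hx, coord_coordField hx,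
    coord_coordField hx] at hcoord

lemma isTorsionFree_of_christoffelCoord_symm {nabla : Connection I M}
    (h : ∀ (x : M) (a b : E), christoffelCoord nabla x (extChartAt I x x) a b =
      christoffelCoord nabla x (extChartAt I x x) b a) : IsTorsionFree nabla := by
  have hE : CompleteSpace E := FiniteDimensional.complete ℝ E
  change nabla.torsion = 0
  funext x
  ext u v
  have hx := mem_chart_source H x
  have htorsion : nabla.torsion x u v = 0 := by
    rw [CovariantDerivative.torsion_apply_eq_extend, extend_eq_coordField, extend_eq_coordField,
      mlieBracket_coordField hx, sub_zero, sub_eq_zero, coordField_coord hx, coordField_coord hx]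
    apply coord_injective hx
    rw [coord_nabla_coordField nabla hx, h, coord_nabla_coordField nabla hx]
  exact htorsion

variable [I.Boundaryless] {nabla : Connection I M}

lemma coord_nabla_ofCoord (nabla : Connection I M) (hx : x ∈ (chartAt H p).source)
    (hY : MDiffAt (T% Y) x) (a : E) :
    coord I p x (nabla Y x (ofCoord I p x a)) =
      fderiv ℝ ((fun y ↦ coord I p y (Y y)) ∘ (extChartAt I p).symm) (extChartAt I p x) a +
        christoffelCoord nabla p (extChartAt I p x) (coord I p x (Y x)) a := by
  rw [coord_nabla nabla hx hY, mvfderiv_eq_fderiv_comp_coord hx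
    ((mdifferentiableAt_section_iff_coord hx Y).1 hY), ContinuousLinearMap.comp_apply,
    coord_ofCoord hx]

lemma HasSmoothChristoffel.contMDiffCovariantDerivative (h : HasSmoothChristoffel nabla) :
    CovariantDerivative.ContMDiffCovariantDerivative nabla ∞ := by
  refine ⟨⟨fun {Y} hY x _ ↦ ContMDiffAt.contMDiffWithinAt ?_⟩⟩
  replace hY : CMDiff ∞ (T% Y) := by simpa [contMDiffOn_univ] using hY
  rw [contMDiffAt_hom_bundle]
  refine ⟨contMDiffAt_id, ?_⟩
  have hφx := mem_extChartAt_target (I := I) x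
  let f : E → E := (fun y ↦ coord I x y (Y y)) ∘ (extChartAt I x).symm
  have hf : ContDiffAt ℝ ∞ f (extChartAt I x x) :=
    contDiffAt_comp_extChartAt_symm hφx
      ((contMDiffAt_section_iff_coord (extChartAt_symm_mem_source hφx) Y).1 (hY _))
  let k : E → E →L[ℝ] E := fun z ↦ fderiv ℝ f z + christoffelCoord nabla x z (f z)
  have hk : ContDiffAt ℝ ∞ k (extChartAt I x x) :=
    (hf.fderiv_right (m := ∞) (by simp)).add
      (((h x).contDiffAt ((isOpen_extChartAt_target x).mem_nhds hφx)).clm_apply hf)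
  refine (hk.contMDiffAt.comp x contMDiffAt_extChartAt).congr_of_eventuallyEq ?_
  filter_upwards [chart_source_mem_nhds (mem_chart_source H x)] with z hz
  ext a
  have hfz : f (extChartAt I x z) = coord I x z (Y z) := by
    simp only [f, Function.comp_apply]
    rw [extChartAt_symm_extChartAt hz]
  calc coord I x z (nabla Y z (ofCoord I x z a))
      = fderiv ℝ f (extChartAt I x z) a +
          christoffelCoord nabla x (extChartAt I x z) (coord I x z (Y z)) a :=
        coord_nabla_ofCoord nabla hz ((hY z).mdifferentiableAt (by simp)) a
    _ = k (extChartAt I x z) a := by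
        rw [← hfz]
        rfl

end Christoffel

section Metric

variable {E : Type*} [NormedAddCommGroup E] [NormedSpace ℝ E] [FiniteDimensional ℝ E]
  {H : Type*} [TopologicalSpace H] {I : ModelWithCorners ℝ E H}
  {M : Type*} [TopologicalSpace M] [ChartedSpace H M] [IsManifold I ∞ M]
  [RiemannianBundle (fun x : M ↦ TangentSpace I x)] {p x : M} {y : E}

variable (I) in
/-- The components of the metric in the chart at `p`, as functions of the coordinates. -/
def metricCoord (p : M) (y : E) : E →L[ℝ] E →L[ℝ] ℝ :=
  letI x := (extChartAt I p).symm y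
  LinearMap.toContinuousBilinearMap <| LinearMap.mk₂ ℝ
    (fun a b ↦ inner ℝ (ofCoord I p x a) (ofCoord I p x b))
    (by simp [inner_add_left]) (by simp [real_inner_smul_left])
    (by simp [inner_add_right]) (by simp [real_inner_smul_right])

lemma metricCoord_apply (p : M) (y a b : E) :
    metricCoord I p y a b = inner ℝ (ofCoord I p ((extChartAt I p).symm y) a)
      (ofCoord I p ((extChartAt I p).symm y) b) := rfl

lemma metricCoord_symm (p : M) (y a b : E) : metricCoord I p y a b = metricCoord I p y b a := by
  rw [metricCoord_apply, metricCoord_apply, real_inner_comm]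

lemma inner_eq_metricCoord (hx : x ∈ (chartAt H p).source) (u v : TangentSpace I x) :
    inner ℝ u v = metricCoord I p (extChartAt I p x) (coord I p x u) (coord I p x v) := by
  rw [metricCoord_apply, extChartAt_symm_extChartAt hx, ofCoord_coord hx, ofCoord_coord hx]

lemma injective_metricCoord (hy : y ∈ (extChartAt I p).target) :
    Function.Injective (metricCoord I p y) := by
  refine (injective_iff_map_eq_zero _).2 fun a ha ↦ ?_
  have hnorm : metricCoord I p y a a = 0 := by
    rw [ha]
    rfl
  rw [metricCoord_apply, inner_self_eq_zero] at hnorm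
  rw [← coord_ofCoord (I := I) (extChartAt_symm_mem_source hy) a, hnorm, map_zero]

lemma inner_coordField_comp_symm_eqOn (p : M) (a b : E) :
    Set.EqOn ((fun x ↦ inner ℝ (coordField I p a x) (coordField I p b x)) ∘ (extChartAt I p).symm)
      (fun y ↦ metricCoord I p y a b) (extChartAt I p).target := by
  intro y hy
  have hx := extChartAt_symm_mem_source hy
  simp only [metricCoord_apply, Function.comp_apply, coordField_apply hx]

variable [IsContMDiffRiemannianBundle I ∞ E (fun x : M ↦ TangentSpace I x)]

lemma nablaMetric_apply (nabla : Connection I M) (u : TangentSpace I x)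
    {Y Z : ∀ x : M, TangentSpace I x} (hY : MDiffAt (T% Y) x) (hZ : MDiffAt (T% Z) x) :
    nablaMetric nabla x u (Y x) (Z x) = d% (fun y : M ↦ inner ℝ (Y y) (Z y)) x u
      - inner ℝ (nabla Y x u) (Z x) - inner ℝ (Y x) (nabla Z x u) := by
  have h := CovariantDerivative.derivMetricTensor_apply (V := fun x : M ↦ TangentSpace I x)
    nabla x (X := FiberBundle.extend E u) hY hZ
  simpa using! h

lemma isMetricCompatible_iff_nablaMetric {nabla : Connection I M} :
    CovariantDerivative.IsMetricCompatible (V := fun x : M ↦ TangentSpace I x) nabla ↔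
      ∀ (x : M) (u v w : TangentSpace I x), nablaMetric nabla x u v w = 0 := by
  constructor
  · intro h x u v w
    rw [nablaMetric, h]
    rfl
  · intro h
    rw [CovariantDerivative.IsMetricCompatible]
    funext x
    ext v w u
    exact h x u v w

variable [I.Boundaryless]

lemma contDiffOn_metricCoord (p : M) :
    ContDiffOn ℝ ∞ (metricCoord I p) (extChartAt I p).target := by
  refine contDiffOn_clm_apply.2 fun a ↦ contDiffOn_clm_apply.2 fun b ↦
    ContDiffOn.congr (fun y hy ↦ ?_) (inner_coordField_comp_symm_eqOn p a b).symm
  have hx := extChartAt_symm_mem_source hy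
  exact (contDiffAt_comp_extChartAt_symm hy
    (ContMDiffAt.inner_bundle (E := fun x : M ↦ TangentSpace I x) (contMDiffAt_coordField hx a)
      (contMDiffAt_coordField hx b))).contDiffWithinAt

lemma contDiffOn_fderiv_metricCoord (p : M) (a b c : E) :
    ContDiffOn ℝ ∞ (fun y ↦ fderiv ℝ (fun z ↦ metricCoord I p z b c) y a)
      (extChartAt I p).target :=
  ((((contDiffOn_metricCoord p).clm_apply contDiffOn_const).clm_apply
    contDiffOn_const).fderiv_of_isOpen (isOpen_extChartAt_target p) (by simp)).clm_apply
    contDiffOn_const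

lemma nablaMetric_eq (nabla : Connection I M) (hx : x ∈ (chartAt H p).source)
    (u v w : TangentSpace I x) :
    nablaMetric nabla x u v w =
      fderiv ℝ (fun y ↦ metricCoord I p y (coord I p x v) (coord I p x w))
        (extChartAt I p x) (coord I p x u)
      - metricCoord I p (extChartAt I p x) (christoffelCoord nabla p (extChartAt I p x)
          (coord I p x v) (coord I p x u)) (coord I p x w)
      - metricCoord I p (extChartAt I p x) (coord I p x v)
          (christoffelCoord nabla p (extChartAt I p x) (coord I p x w) (coord I p x u)) := by
  have hv := mdifferentiableAt_coordField (I := I) hx (coord I p x v)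
  have hw := mdifferentiableAt_coordField (I := I) hx (coord I p x w)
  have heq := (inner_coordField_comp_symm_eqOn (I := I) p (coord I p x v)
    (coord I p x w)).eventuallyEq_of_mem
      ((isOpen_extChartAt_target p).mem_nhds (extChartAt_mem_target hx))
  have hinner : MDiffAt (fun y ↦ inner ℝ (coordField I p (coord I p x v) y)
      (coordField I p (coord I p x w) y)) x :=
    MDifferentiableAt.inner_bundle (E := fun x : M ↦ TangentSpace I x) hv hw
  have h := nablaMetric_apply nabla u hv hw
  rw [coordField_coord hx, coordField_coord hx] at h
  rw [h, inner_eq_metricCoord hx, inner_eq_metricCoord hx, coord_nabla_coordField _ hx,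
    coord_nabla_coordField _ hx, mvfderiv_eq_fderiv_comp_coord hx hinner, heq.fderiv_eq]
  rfl

/-- `A` is a smooth covariant tensor field, expressed by its components in every chart. -/
def HasSmoothComponents
    (A : ∀ x : M, TangentSpace I x → TangentSpace I x → TangentSpace I x → ℝ) : Prop :=
  ∀ (p : M) (a b c : E), ContDiffOn ℝ ∞ (fun y ↦ A ((extChartAt I p).symm y)
    (ofCoord I p _ a) (ofCoord I p _ b) (ofCoord I p _ c)) (extChartAt I p).target

variable {nabla : Connection I M}

/-- The Koszul formula, with correction terms for a connection that is not metric. -/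
lemma IsTorsionFree.two_mul_metricCoord_christoffelCoord (h : IsTorsionFree nabla)
    (hy : y ∈ (extChartAt I p).target) (a b c : E) :
    2 * metricCoord I p y (christoffelCoord nabla p y a b) c =
      fderiv ℝ (fun z ↦ metricCoord I p z b c) y a + fderiv ℝ (fun z ↦ metricCoord I p z a c) y b
        - fderiv ℝ (fun z ↦ metricCoord I p z a b) y c
      - nablaMetric nabla ((extChartAt I p).symm y) (ofCoord I p _ a) (ofCoord I p _ b)
          (ofCoord I p _ c)
      - nablaMetric nabla ((extChartAt I p).symm y) (ofCoord I p _ b) (ofCoord I p _ a)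
          (ofCoord I p _ c)
      + nablaMetric nabla ((extChartAt I p).symm y) (ofCoord I p _ c) (ofCoord I p _ a)
          (ofCoord I p _ b) := by
  have hx := extChartAt_symm_mem_source hy
  simp only [nablaMetric_eq nabla hx, coord_ofCoord hx, (extChartAt I p).right_inv hy]
  rw [h.christoffelCoord_symm hy b a, h.christoffelCoord_symm hy c a,
    h.christoffelCoord_symm hy c b, metricCoord_symm p y (christoffelCoord nabla p y a c) b]
  ring

lemma IsTorsionFree.hasSmoothChristoffel (h : IsTorsionFree nabla)
    (hC : HasSmoothComponents (nablaMetric nabla)) : HasSmoothChristoffel nabla := by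
  intro p
  have hD := contDiffOn_fderiv_metricCoord (I := I) p
  refine contDiffOn_clm_apply.2 fun a ↦ contDiffOn_clm_apply.2 fun b ↦
    contDiffOn_of_contDiffOn_injective (isOpen_extChartAt_target p) (contDiffOn_metricCoord p)
      (fun y hy ↦ injective_metricCoord hy) fun c ↦ ?_
  refine ((((((hD a b c).add (hD b a c)).sub (hD c a b)).sub (hC p a b c)).sub (hC p b a c)).add
    (hC p c a b)).const_smul (1 / 2 : ℝ) |>.congr fun y hy ↦ ?_
  have hkoszul := h.two_mul_metricCoord_christoffelCoord hy a b c
  simp only [smul_eq_mul]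
  linarith

lemma exists_symm_bilinear_fderiv_metricCoord (x : M) :
    ∃ B : E →L[ℝ] E →L[ℝ] E, (∀ a b, B a b = B b a) ∧ ∀ a b c,
      fderiv ℝ (fun y ↦ metricCoord I x y b c) (extChartAt I x x) a =
        metricCoord I x (extChartAt I x x) (B b a) c +
          metricCoord I x (extChartAt I x x) b (B c a) :=
  exists_symm_bilinear_of_fderiv (((contDiffOn_metricCoord x).contDiffAt
      (extChartAt_target_mem_nhds x)).differentiableAt (by simp))
    (injective_metricCoord (mem_extChartAt_target x)) (metricCoord_symm x)

end Metric

section LeviCivita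

variable {E : Type*} [NormedAddCommGroup E] [NormedSpace ℝ E] [FiniteDimensional ℝ E]
  {H : Type*} [TopologicalSpace H] {I : ModelWithCorners ℝ E H}
  {M : Type*} [TopologicalSpace M] [ChartedSpace H M] [IsManifold I ∞ M]

/-- The connection with prescribed Christoffel symbols `B x` at the centre `x` of the chart at `x`.
-/
def ofChristoffel (B : M → E →L[ℝ] E →L[ℝ] E) : Connection I M where
  toFun Y x := flatDeriv I x Y x + ofCoord I x x ∘L B x (coord I x x (Y x)) ∘L coord I x x
  isCovariantDerivativeOnUniv :=
    { add := fun {Y Z x} hY hZ _ ↦ by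
        rw [flatDeriv_add (mem_chart_source H x) hY hZ]
        ext u
        simp
        abel
      leibniz := fun {Y f x} hY hf _ ↦ by
        rw [flatDeriv_smul (mem_chart_source H x) hY hf]
        ext u
        simp
        abel }

lemma christoffelCoord_ofChristoffel (B : M → E →L[ℝ] E →L[ℝ] E) (x : M) :
    christoffelCoord (ofChristoffel (I := I) B) x (extChartAt I x x) = B x := by
  have hx := mem_chart_source H x
  ext a b
  have hadd : ofChristoffel B (coordField I x a) x = flatDeriv I x (coordField I x a) x +
      ofCoord I x x ∘L B x (coord I x x (coordField I x a x)) ∘L coord I x x := rfl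
  rw [nabla_eq_flatDeriv_add_christoffel _ hx (mdifferentiableAt_coordField hx a),
    add_right_inj] at hadd
  have hcoord := congrArg (coord I x x) (DFunLike.congr_fun hadd (ofCoord I x x b))
  rw [coord_christoffel _ hx, coord_coordField hx, coord_ofCoord hx] at hcoord
  rw [hcoord]
  simp [coord_ofCoord hx]

variable [I.Boundaryless] [RiemannianBundle (fun x : M ↦ TangentSpace I x)]
  [IsContMDiffRiemannianBundle I ∞ E (fun x : M ↦ TangentSpace I x)]

theorem exists_isLeviCivita : ∃ lc : Connection I M, IsLeviCivita lc := by
  choose B hsymm hmetric using exists_symm_bilinear_fderiv_metricCoord (I := I) (M := M)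
  refine ⟨ofChristoffel B, isTorsionFree_of_christoffelCoord_symm fun x a b ↦ ?_,
    isMetricCompatible_iff_nablaMetric.2 fun x u v w ↦ ?_⟩
  · rw [christoffelCoord_ofChristoffel, hsymm]
  · rw [nablaMetric_eq _ (mem_chart_source H x), christoffelCoord_ofChristoffel, hmetric]
    ring

end LeviCivita

section CubicForm

variable {E : Type*} [NormedAddCommGroup E] [NormedSpace ℝ E] [FiniteDimensional ℝ E]
  {H : Type*} [TopologicalSpace H] {I : ModelWithCorners ℝ E H}
  {M : Type*} [TopologicalSpace M] [ChartedSpace H M]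

section SymDerivMetric

variable [RiemannianBundle (fun x : M ↦ TangentSpace I x)] (σ : M → ℝ) (x : M)
  (u v w : TangentSpace I x)

omit [FiniteDimensional ℝ E]

lemma symDerivMetric_apply : symDerivMetric σ x u v w =
    (d% σ x u * inner ℝ v w + d% σ x v * inner ℝ u w + d% σ x w * inner ℝ u v) / 3 := by
  simp only [symDerivMetric, sym]
  rw [real_inner_comm v w, real_inner_comm u w, real_inner_comm u v]
  ring

lemma symDerivMetric_swap₁₂ : symDerivMetric σ x u v w = symDerivMetric σ x v u w := by
  rw [symDerivMetric_apply, symDerivMetric_apply, real_inner_comm u v]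
  ring

lemma symDerivMetric_swap₂₃ : symDerivMetric σ x u v w = symDerivMetric σ x u w v := by
  rw [symDerivMetric_apply, symDerivMetric_apply, real_inner_comm v w]
  ring

lemma symDerivMetric_self : symDerivMetric σ x u u u = d% σ x u * inner ℝ u u := by
  rw [symDerivMetric_apply]
  ring

lemma symDerivMetric_neg : symDerivMetric (I := I) (-σ) = -symDerivMetric σ := by
  funext x u v w
  simp only [Pi.neg_apply, symDerivMetric_apply, mvfderiv_neg, neg_apply]
  ring

end SymDerivMetric

/-- The difference tensor with cubic form `symDerivMetric σ` is
`K_u v = ⅓ (dσ(u) v + dσ(v) u + g(u, v) grad σ)`. -/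
lemma exists_inner_eq_symDerivMetric [RiemannianBundle (fun x : M ↦ TangentSpace I x)]
    (σ : M → ℝ) (x : M) :
    ∃ K : TangentSpace I x →L[ℝ] TangentSpace I x →L[ℝ] TangentSpace I x,
      ∀ u v w, symDerivMetric σ x u v w = inner ℝ (K v u) w := by
  have hfin : FiniteDimensional ℝ (TangentSpace I x) := inferInstanceAs (FiniteDimensional ℝ E)
  have hcomplete : CompleteSpace (TangentSpace I x) := FiniteDimensional.complete ℝ _
  let df : TangentSpace I x →L[ℝ] ℝ := d% σ x
  let grad : TangentSpace I x := (InnerProductSpace.toDual ℝ (TangentSpace I x)).symm df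
  have inner_grad (w : TangentSpace I x) : inner ℝ grad w = df w :=
    InnerProductSpace.toDual_symm_apply
  let K := LinearMap.toContinuousBilinearMap <| LinearMap.mk₂ ℝ
    (fun v u : TangentSpace I x ↦
      (1 / 3 : ℝ) • (df u • v + df v • u + (inner ℝ u v : ℝ) • grad))
    (fun v v' u ↦ by rw [map_add, inner_add_right]; module)
    (fun r v u ↦ by rw [map_smul, real_inner_smul_right, smul_eq_mul]; module)
    (fun v u u' ↦ by rw [map_add, inner_add_left]; module)
    (fun r v u ↦ by rw [map_smul, real_inner_smul_left, smul_eq_mul]; module)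
  refine ⟨K, fun u v w ↦ ?_⟩
  change _ = inner ℝ ((1 / 3 : ℝ) • (df u • v + df v • u + (inner ℝ u v : ℝ) • grad)) w
  rw [real_inner_smul_left, inner_add_left, inner_add_left, real_inner_smul_left,
    real_inner_smul_left, real_inner_smul_left, inner_grad, symDerivMetric_apply]
  ring

variable [IsManifold I ∞ M]

omit [FiniteDimensional ℝ E] in
lemma exists_section_eq {x : M} (u : TangentSpace I x) :
    ∃ U : ∀ y : M, TangentSpace I y, MDiffAt (T% U) x ∧ U x = u :=
  ⟨coordField I x (coord I x x u), mdifferentiableAt_coordField (mem_chart_source H x) _,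
    coordField_coord (mem_chart_source H x) u⟩

lemma nabla_eq_add_difference (nabla lc : Connection I M) {x : M}
    {Y : ∀ y : M, TangentSpace I y} (hY : MDiffAt (T% Y) x) :
    nabla Y x = lc Y x + nabla.difference lc x (Y x) := by
  have h : nabla.difference lc x (Y x) = nabla Y x - lc Y x :=
    IsCovariantDerivativeOn.difference_apply _ _ (Set.mem_univ x) hY
  rw [h]
  abel

lemma difference_addOneForm (lc : Connection I M)
    (K : ∀ x : M, TangentSpace I x →L[ℝ] TangentSpace I x →L[ℝ] TangentSpace I x) (x : M) :
    CovariantDerivative.difference (lc.addOneForm K) lc x = K x := by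
  refine ContinuousLinearMap.ext fun v ↦ ?_
  obtain ⟨V, hV, rfl⟩ := exists_section_eq v
  exact (add_left_cancel (nabla_eq_add_difference (lc.addOneForm K) lc hV)).symm

lemma IsTorsionFree.of_difference {nabla lc : Connection I M} (hlc : IsTorsionFree lc)
    (h : ∀ (x : M) (u v : TangentSpace I x),
      nabla.difference lc x u v = nabla.difference lc x v u) : IsTorsionFree nabla := by
  have hE : CompleteSpace E := FiniteDimensional.complete ℝ E
  refine (CovariantDerivative.torsion_eq_zero_iff nabla).2 fun {U V x} hU hV ↦ ?_
  have htorsion := (CovariantDerivative.torsion_eq_zero_iff lc).1 hlc hU hV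
  rwa [nabla_eq_add_difference nabla lc hU, nabla_eq_add_difference nabla lc hV, add_apply,
    add_apply, h, add_sub_add_right_eq_sub]

variable [RiemannianBundle (fun x : M ↦ TangentSpace I x)]
  [IsContMDiffRiemannianBundle I ∞ E (fun x : M ↦ TangentSpace I x)]
  {nabla nabla' lc : Connection I M}
  {A : ∀ x : M, TangentSpace I x → TangentSpace I x → TangentSpace I x → ℝ}

lemma nablaMetric_eq_sub_difference (nabla lc : Connection I M) (x : M) (u v w : TangentSpace I x) :
    nablaMetric nabla x u v w = nablaMetric lc x u v w
      - inner ℝ (nabla.difference lc x v u) w - inner ℝ v (nabla.difference lc x w u) := by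
  obtain ⟨V, hV, rfl⟩ := exists_section_eq v
  obtain ⟨W, hW, rfl⟩ := exists_section_eq w
  rw [nablaMetric_apply nabla u hV hW, nablaMetric_apply lc u hV hW,
    nabla_eq_add_difference nabla lc hV, nabla_eq_add_difference nabla lc hW, add_apply, add_apply,
    inner_add_left, inner_add_right]
  ring

lemma IsLeviCivita.mvfderiv_inner (hlc : IsLeviCivita lc) {x : M} (u : TangentSpace I x)
    {Y Z : ∀ x : M, TangentSpace I x} (hY : MDiffAt (T% Y) x) (hZ : MDiffAt (T% Z) x) :
    d% (fun y : M ↦ inner ℝ (Y y) (Z y)) x u =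
      inner ℝ (lc Y x u) (Z x) + inner ℝ (Y x) (lc Z x u) := by
  have h := nablaMetric_apply lc u hY hZ
  rw [isMetricCompatible_iff_nablaMetric.1 hlc.2] at h
  linarith

lemma IsLeviCivita.isDual_iff_difference (hlc : IsLeviCivita lc) :
    IsDual nabla nabla' ↔ ∀ (x : M) (u v w : TangentSpace I x),
      inner ℝ (nabla.difference lc x v u) w + inner ℝ v (nabla'.difference lc x w u) = 0 := by
  have h {x : M} (u : TangentSpace I x) {V W : ∀ x : M, TangentSpace I x}
      (hV : MDiffAt (T% V) x) (hW : MDiffAt (T% W) x) :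
      d% (fun y : M ↦ inner ℝ (V y) (W y)) x u =
          inner ℝ (nabla V x u) (W x) + inner ℝ (V x) (nabla' W x u) ↔
        inner ℝ (nabla.difference lc x (V x) u) (W x) +
          inner ℝ (V x) (nabla'.difference lc x (W x) u) = 0 := by
    rw [hlc.mvfderiv_inner u hV hW, nabla_eq_add_difference nabla lc hV,
      nabla_eq_add_difference nabla' lc hW, add_apply, add_apply, inner_add_left, inner_add_right]
    constructor <;> intro _ <;> linarith
  refine ⟨fun hdual x u v w ↦ ?_, fun hdiff x u V W hV hW ↦ (h u hV hW).2 (hdiff x u _ _)⟩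
  obtain ⟨V, hV, rfl⟩ := exists_section_eq v
  obtain ⟨W, hW, rfl⟩ := exists_section_eq w
  exact (h u hV hW).1 (hdual x u V W hV hW)

lemma HasCubicForm.isTorsionFree (h : HasCubicForm nabla A)
    (hA : ∀ x u v w, A x u v w = A x v u w) : IsTorsionFree nabla := by
  obtain ⟨lc, hlc, hK⟩ := h
  refine hlc.1.of_difference fun x u v ↦ ext_inner_right ℝ fun w ↦ ?_
  rw [← hK, ← hK, hA]

lemma HasCubicForm.nablaMetric_eq (h : HasCubicForm nabla A)
    (hA : ∀ x u v w, A x u v w = A x u w v) (x : M) (u v w : TangentSpace I x) :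
    nablaMetric nabla x u v w = -2 * A x u v w := by
  obtain ⟨lc, hlc, hK⟩ := h
  rw [nablaMetric_eq_sub_difference nabla lc, isMetricCompatible_iff_nablaMetric.1 hlc.2, ← hK,
    real_inner_comm, ← hK, hA x u w v]
  ring

lemma HasCubicForm.exists_isDual (h : HasCubicForm nabla A)
    (hA : ∀ x u v w, A x u v w = A x u w v) : ∃ nabla', IsDual nabla nabla' := by
  obtain ⟨lc, hlc, hK⟩ := h
  refine ⟨lc.addOneForm fun x ↦ -nabla.difference lc x,
    hlc.isDual_iff_difference.2 fun x u v w ↦ ?_⟩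
  rw [difference_addOneForm, neg_apply, neg_apply, inner_neg_right, real_inner_comm _ v, ← hK,
    ← hK, hA]
  ring

lemma HasCubicForm.dual (h : HasCubicForm nabla A) (hA : ∀ x u v w, A x u v w = A x u w v)
    (hdual : IsDual nabla nabla') : HasCubicForm nabla' (-A) := by
  obtain ⟨lc, hlc, hK⟩ := h
  refine ⟨lc, hlc, fun x u v w ↦ ?_⟩
  have hsum := hlc.isDual_iff_difference.1 hdual x u w v
  rw [← hK, hA, real_inner_comm] at hsum
  simp only [Pi.neg_apply]
  linarith

variable [I.Boundaryless]

lemma HasCubicForm.hasSmoothChristoffel (h : HasCubicForm nabla A)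
    (hA₁₂ : ∀ x u v w, A x u v w = A x v u w) (hA₂₃ : ∀ x u v w, A x u v w = A x u w v)
    (hA : HasSmoothComponents A) : HasSmoothChristoffel nabla := by
  refine (h.isTorsionFree hA₁₂).hasSmoothChristoffel fun p a b c ↦ ?_
  simp only [h.nablaMetric_eq hA₂₃]
  exact contDiffOn_const.mul (hA p a b c)

theorem HasCubicForm.isStatistical (h : HasCubicForm nabla A)
    (hA₁₂ : ∀ x u v w, A x u v w = A x v u w) (hA₂₃ : ∀ x u v w, A x u v w = A x u w v)
    (hA : HasSmoothComponents A) : IsStatistical nabla where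
  smooth := (h.hasSmoothChristoffel hA₁₂ hA₂₃ hA).contMDiffCovariantDerivative
  torsionFree := h.isTorsionFree hA₁₂
  symm₁₂ x u v w := by simp only [h.nablaMetric_eq hA₂₃, hA₁₂ x u v]
  symm₂₃ x u v w := by simp only [h.nablaMetric_eq hA₂₃, hA₂₃ x u v]

theorem exists_hasCubicForm
    (hA : ∀ x, ∃ K : TangentSpace I x →L[ℝ] TangentSpace I x →L[ℝ] TangentSpace I x,
      ∀ u v w, A x u v w = inner ℝ (K v u) w) :
    ∃ nabla : Connection I M, HasCubicForm nabla A := by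
  obtain ⟨lc, hlc⟩ := exists_isLeviCivita (I := I) (M := M)
  choose K hK using hA
  exact ⟨lc.addOneForm K, lc, hlc, fun x u v w ↦ by rw [difference_addOneForm, hK]⟩

lemma hasSmoothComponents_symDerivMetric {σ : M → ℝ} (hσ : CMDiff ∞ σ) :
    HasSmoothComponents (symDerivMetric (I := I) σ) := by
  intro p a b c
  have hf : ContDiffOn ℝ ∞ (σ ∘ (extChartAt I p).symm) (extChartAt I p).target :=
    fun y hy ↦ (contDiffAt_comp_extChartAt_symm hy hσ.contMDiffAt).contDiffWithinAt
  have hd (a : E) : ContDiffOn ℝ ∞ (fun y ↦ fderiv ℝ (σ ∘ (extChartAt I p).symm) y a)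
      (extChartAt I p).target :=
    (hf.fderiv_of_isOpen (isOpen_extChartAt_target p) (by simp)).clm_apply contDiffOn_const
  have hg (a b : E) : ContDiffOn ℝ ∞ (fun y ↦ metricCoord I p y a b) (extChartAt I p).target :=
    ((contDiffOn_metricCoord p).clm_apply contDiffOn_const).clm_apply contDiffOn_const
  refine (((((hd a).mul (hg b c)).add ((hd b).mul (hg a c))).add ((hd c).mul (hg a b))).div_const
    3).congr fun y hy ↦ ?_
  have hx := extChartAt_symm_mem_source hy
  have hdσ (a : E) : d% σ ((extChartAt I p).symm y) (ofCoord I p _ a) =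
      fderiv ℝ (σ ∘ (extChartAt I p).symm) y a := by
    rw [mvfderiv_eq_fderiv_comp_coord hx (hσ.mdifferentiable (by simp) _),
      ContinuousLinearMap.comp_apply, coord_ofCoord hx, (extChartAt I p).right_inv hy]
  rw [symDerivMetric_apply, hdσ, hdσ, hdσ]
  rfl

end CubicForm

section AlongCurve

variable {E : Type*} [NormedAddCommGroup E] [NormedSpace ℝ E]
  {H : Type*} [TopologicalSpace H] {I : ModelWithCorners ℝ E H}
  {M : Type*} [TopologicalSpace M] [ChartedSpace H M] {γ : ℝ → M} {t : ℝ}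

lemma hasDerivAt_comp_curve {F : Type*} [NormedAddCommGroup F] [NormedSpace ℝ F] {f : M → F}
    (hf : MDiffAt f (γ t)) (hγ : MDifferentiableAt 𝓘(ℝ) I γ t) :
    HasDerivAt (f ∘ γ) (d% f (γ t) (velocity I γ t)) t := by
  have hcomp : HasFDerivAt (f ∘ γ) ((d% f (γ t)).comp (mfderiv 𝓘(ℝ) I γ t) : ℝ →L[ℝ] F) t :=
    (hf.hasMFDerivAt.comp t hγ.hasMFDerivAt).hasFDerivAt
  exact hcomp.hasDerivAt

variable [IsManifold I ∞ M] {p q x : M} {Y : ∀ t, TangentSpace I (γ t)}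

lemma coord_velocity (hx : γ t ∈ (chartAt H p).source) (hγ : MDifferentiableAt 𝓘(ℝ) I γ t) :
    coord I p (γ t) (velocity I γ t) = deriv (extChartAt I p ∘ γ) t := by
  have hchart : MDiffAt (extChartAt I p) (γ t) :=
    (contMDiffAt_extChartAt' (n := ∞) hx).mdifferentiableAt (by simp)
  rw [coord_eq_mfderiv hx, (hasDerivAt_comp_curve hchart hγ).deriv]
  rfl

lemma mdifferentiableAt_coordChange (hp : x ∈ (chartAt H p).source)
    (hq : x ∈ (chartAt H q).source) : MDiffAt (coordChange I p q) x :=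
  (contMDiffAt_coordChange hp hq).mdifferentiableAt (by simp)

lemma hasDerivAt_coord_of_coordChange (hp : γ t ∈ (chartAt H p).source)
    (hq : γ t ∈ (chartAt H q).source) (hγ : MDifferentiableAt 𝓘(ℝ) I γ t)
    (hY : DifferentiableAt ℝ (fun s ↦ coord I p (γ s) (Y s)) t) :
    HasDerivAt (fun s ↦ coord I q (γ s) (Y s))
      (d% (coordChange I p q) (γ t) (velocity I γ t) (coord I p (γ t) (Y t)) +
        coordChange I p q (γ t) (deriv (fun s ↦ coord I p (γ s) (Y s)) t)) t := by
  have hchange := hasDerivAt_comp_curve (mdifferentiableAt_coordChange hp hq) hγ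
  refine (hchange.clm_apply hY.hasDerivAt).congr_of_eventuallyEq ?_
  filter_upwards [hγ.continuousAt.eventually (chart_source_mem_nhds hp)] with s hs
    using coord_eq_coordChange hs (Y s)

lemma mvfderiv_coord_coordField (hp : x ∈ (chartAt H p).source)
    (hq : x ∈ (chartAt H q).source) (a : E) (u : TangentSpace I x) :
    d% (fun y ↦ coord I q y (coordField I p a y)) x u = d% (coordChange I p q) x u a := by
  have heq : (fun y ↦ coord I q y (coordField I p a y)) =ᶠ[nhds x]
      ContinuousLinearMap.apply ℝ E a ∘ coordChange I p q := by
    filter_upwards [chart_source_mem_nhds hp] with y hy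
    rw [coordField_apply hy]
    rfl
  rw [mvfderiv, heq.mfderiv_eq, mfderiv_comp x
    (ContinuousLinearMap.apply ℝ E a).differentiableAt.mdifferentiableAt
    (mdifferentiableAt_coordChange hp hq), ContinuousLinearMap.mfderiv_eq]
  rfl

variable [FiniteDimensional ℝ E]

lemma coord_covDerivAlong_self (nabla : Connection I M) (hγ : ContinuousAt γ t) :
    coord I (γ t) (γ t) (covDerivAlong nabla γ Y t) =
      deriv (fun s ↦ coord I (γ t) (γ s) (Y s)) t +
        christoffelCoord nabla (γ t) (extChartAt I (γ t) (γ t)) (coord I (γ t) (γ t) (Y t))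
          (coord I (γ t) (γ t) (velocity I γ t)) := by
  have hx := mem_chart_source H (γ t)
  have hY : (fun s ↦ coord I (γ t) (γ s) (Y s)) =ᶠ[nhds t] fun s ↦
      (trivializationAt E (TangentSpace I : M → Type _) (γ t)
        (⟨γ s, Y s⟩ : TangentBundle I M)).2 := by
    filter_upwards [hγ.eventually (chart_source_mem_nhds hx)] with s hs using coord_apply hs _
  rw [covDerivAlong, ← hY.deriv_eq, extend_eq_coordField, map_add, coord_nabla_coordField nabla hx]
  congr 1
  exact coord_coordField hx _

/-- Both sides are compared in the chart at `γ t`: the derivatives of the coordinate change coming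
from the components of `Y` and from the coordinate fields agree. -/
lemma covDerivAlong_eq (nabla : Connection I M) (hx : γ t ∈ (chartAt H p).source)
    (hγ : MDifferentiableAt 𝓘(ℝ) I γ t)
    (hY : DifferentiableAt ℝ (fun s ↦ coord I p (γ s) (Y s)) t) :
    covDerivAlong nabla γ Y t =
      ofCoord I p (γ t) (deriv (fun s ↦ coord I p (γ s) (Y s)) t) +
        nabla (coordField I p (coord I p (γ t) (Y t))) (γ t) (velocity I γ t) := by
  have hself := mem_chart_source H (γ t)
  apply coord_injective hself
  rw [coord_covDerivAlong_self nabla hγ.continuousAt, map_add, coord_nabla nabla hself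
    (mdifferentiableAt_coordField hx _), mvfderiv_coord_coordField hx hself, coordField_coord hx,
    (hasDerivAt_coord_of_coordChange hx hself hγ hY).deriv, coordChange,
    ContinuousLinearMap.comp_apply]
  abel

lemma coord_covDerivAlong (nabla : Connection I M) (hx : γ t ∈ (chartAt H p).source)
    (hγ : MDifferentiableAt 𝓘(ℝ) I γ t)
    (hY : DifferentiableAt ℝ (fun s ↦ coord I p (γ s) (Y s)) t) :
    coord I p (γ t) (covDerivAlong nabla γ Y t) = deriv (fun s ↦ coord I p (γ s) (Y s)) t +
      christoffelCoord nabla p (extChartAt I p (γ t)) (coord I p (γ t) (Y t))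
        (coord I p (γ t) (velocity I γ t)) := by
  rw [covDerivAlong_eq nabla hx hγ hY, map_add, coord_ofCoord hx, coord_nabla_coordField nabla hx]

end AlongCurve

section GeodesicEquation

variable {E : Type*} [NormedAddCommGroup E] [NormedSpace ℝ E]
  {H : Type*} [TopologicalSpace H] {I : ModelWithCorners ℝ E H}
  {M : Type*} [TopologicalSpace M] [ChartedSpace H M] {γ : ℝ → M} {t : ℝ} {p : M}

variable (I) in
/-- Position and velocity of a curve in `M`, in the coordinates of the chart at `p`. -/
def phaseCurve (p : M) (γ : ℝ → M) (t : ℝ) : E × E :=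
  (extChartAt I p (γ t), deriv (extChartAt I p ∘ γ) t)

lemma phaseCurve_congr {δ : ℝ → M} (h : δ =ᶠ[nhds t] γ) :
    phaseCurve I p δ =ᶠ[nhds t] phaseCurve I p γ :=
  (h.fun_comp (extChartAt I p)).prodMk (h.fun_comp (extChartAt I p)).deriv

lemma phaseCurve_extChartAt_symm {α : ℝ → E × E} {J : Set ℝ} (hJ : IsOpen J)
    (htarget : ∀ t ∈ J, (α t).1 ∈ (extChartAt I p).target)
    (hderiv : ∀ t ∈ J, HasDerivAt (fun s ↦ (α s).1) (α t).2 t) :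
    Set.EqOn (phaseCurve I p fun t ↦ (extChartAt I p).symm (α t).1) α J := by
  intro t ht
  have heq : Set.EqOn (extChartAt I p ∘ fun t ↦ (extChartAt I p).symm (α t).1)
      (fun t ↦ (α t).1) J := fun s hs ↦ (extChartAt I p).right_inv (htarget s hs)
  refine Prod.ext (heq ht) ?_
  rw [phaseCurve, (heq.eventuallyEq_of_mem (hJ.mem_nhds ht)).deriv_eq, (hderiv t ht).deriv]

variable [IsManifold I ∞ M]

lemma contDiffAt_extChartAt_comp {n : ℕ} (hγ : ContMDiffAt 𝓘(ℝ) I n γ t)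
    (hx : γ t ∈ (chartAt H p).source) : ContDiffAt ℝ n (extChartAt I p ∘ γ) t := by
  have hchart : ContMDiffAt I 𝓘(ℝ, E) n (extChartAt I p) (γ t) :=
    (contMDiffAt_extChartAt' (n := ∞) hx).of_le (by exact_mod_cast le_top)
  exact (hchart.comp t hγ).contDiffAt

lemma differentiableAt_phaseCurve (hγ : ContMDiffAt 𝓘(ℝ) I 2 γ t)
    (hx : γ t ∈ (chartAt H p).source) : DifferentiableAt ℝ (phaseCurve I p γ) t := by
  have hcoord : ContDiffAt ℝ 2 (extChartAt I p ∘ γ) t := contDiffAt_extChartAt_comp hγ hx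
  exact (hcoord.differentiableAt (by simp)).prodMk
    ((hcoord.derivWithin (m := 1) (by norm_num)).differentiableAt (by simp))

lemma coord_velocity_eventuallyEq (hγ : ContMDiffAt 𝓘(ℝ) I 2 γ t)
    (hx : γ t ∈ (chartAt H p).source) :
    (fun s ↦ coord I p (γ s) (velocity I γ s)) =ᶠ[nhds t] fun s ↦ (phaseCurve I p γ s).2 := by
  have : IsManifold I 2 M := .of_le (n := ∞) ENat.LEInfty.out
  filter_upwards [(contMDiffAt_iff_contMDiffAt_nhds (by simp)).1 hγ,
    hγ.continuousAt.eventually (chart_source_mem_nhds hx)] with s hsmooth hs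
  exact coord_velocity hs (hsmooth.mdifferentiableAt (by simp))

variable {nabla : Connection I M} {s u : Set ℝ}

lemma IsGeodesicOn.mono (h : IsGeodesicOn nabla γ u) (hsu : s ⊆ u) : IsGeodesicOn nabla γ s :=
  ⟨h.1.mono hsu, fun t ht ↦ h.2 t (hsu ht)⟩

lemma IsGeodesicOn.contMDiffAt (h : IsGeodesicOn nabla γ s) (hs : IsOpen s) (ht : t ∈ s) :
    ContMDiffAt 𝓘(ℝ) I 2 γ t :=
  h.1.contMDiffAt (hs.mem_nhds ht)

variable [FiniteDimensional ℝ E]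

/-- The geodesic equation `x'' = -Γ(x', x')` in the chart at `p`, as a vector field on phase
space. -/
def geodesicField (nabla : Connection I M) (p : M) (z : E × E) : E × E :=
  (z.2, -christoffelCoord nabla p z.1 z.2 z.2)

lemma HasSmoothChristoffel.contDiffOn_geodesicField (hnabla : HasSmoothChristoffel nabla) (p : M) :
    ContDiffOn ℝ 1 (geodesicField nabla p) ((extChartAt I p).target ×ˢ Set.univ) := by
  have hΓ : ContDiffOn ℝ ∞ (fun z : E × E ↦ christoffelCoord nabla p z.1)
      ((extChartAt I p).target ×ˢ Set.univ) := (hnabla p).comp contDiffOn_fst fun z hz ↦ hz.1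
  exact (contDiffOn_snd.prodMk ((hΓ.clm_apply contDiffOn_snd).clm_apply contDiffOn_snd).neg).of_le
    ENat.LEInfty.out

lemma covDerivAlong_velocity_eq_zero_iff (nabla : Connection I M)
    (hγ : ContMDiffAt 𝓘(ℝ) I 2 γ t) (hx : γ t ∈ (chartAt H p).source) :
    covDerivAlong nabla γ (velocity I γ) t = 0 ↔
      HasDerivAt (phaseCurve I p γ) (geodesicField nabla p (phaseCurve I p γ t)) t := by
  have hγ' : MDifferentiableAt 𝓘(ℝ) I γ t := hγ.mdifferentiableAt (by simp)
  have hphase := differentiableAt_phaseCurve hγ hx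
  have hvel := coord_velocity_eventuallyEq hγ hx
  have hcoord := coord_covDerivAlong nabla hx hγ' (hphase.snd.congr_of_eventuallyEq hvel)
  rw [hvel.deriv_eq, coord_velocity hx hγ'] at hcoord
  have hderiv : deriv (phaseCurve I p γ) t =
      (deriv (extChartAt I p ∘ γ) t, deriv (fun s ↦ (phaseCurve I p γ s).2) t) :=
    (hphase.fst.hasDerivAt.prodMk hphase.snd.hasDerivAt).deriv
  calc covDerivAlong nabla γ (velocity I γ) t = 0
    _ ↔ coord I p (γ t) (covDerivAlong nabla γ (velocity I γ) t) = 0 :=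
        (map_eq_zero_iff _ (coord_injective hx)).symm
    _ ↔ deriv (phaseCurve I p γ) t = geodesicField nabla p (phaseCurve I p γ t) := by
        simp only [hcoord, hderiv, geodesicField, phaseCurve, Prod.mk_right_inj,
          eq_neg_iff_add_eq_zero]
    _ ↔ HasDerivAt (phaseCurve I p γ) (geodesicField nabla p (phaseCurve I p γ t)) t :=
        ⟨fun h ↦ h ▸ hphase.hasDerivAt, HasDerivAt.deriv⟩

lemma IsGeodesicOn.hasDerivAt_phaseCurve (h : IsGeodesicOn nabla γ s) (hs : IsOpen s)
    (ht : t ∈ s) (hx : γ t ∈ (chartAt H p).source) :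
    HasDerivAt (phaseCurve I p γ) (geodesicField nabla p (phaseCurve I p γ t)) t :=
  (covDerivAlong_velocity_eq_zero_iff nabla (h.contMDiffAt hs ht) hx).1 (h.2 t ht)

lemma contDiffOn_two_of_hasDerivAt {F : Type*} [NormedAddCommGroup F] [NormedSpace ℝ F]
    {f : F → F} {Ω : Set F} (hf : ContDiffOn ℝ 1 f Ω) {α : ℝ → F} {J : Set ℝ} (hJ : IsOpen J)
    (hα : ∀ t ∈ J, α t ∈ Ω ∧ HasDerivAt α (f (α t)) t) : ContDiffOn ℝ 2 α J := by
  have hdiff : DifferentiableOn ℝ α J := fun t ht ↦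
    (hα t ht).2.differentiableAt.differentiableWithinAt
  have hderiv : Set.EqOn (deriv α) (f ∘ α) J := fun t ht ↦ (hα t ht).2.deriv
  have hmaps : Set.MapsTo α J Ω := fun t ht ↦ (hα t ht).1
  have hone : ContDiffOn ℝ (0 + 1) α J :=
    (contDiffOn_succ_iff_deriv_of_isOpen hJ).2 ⟨hdiff, by simp, contDiffOn_zero.2
      ((hf.continuousOn.comp hdiff.continuousOn hmaps).congr hderiv)⟩
  rw [zero_add] at hone
  rw [← one_add_one_eq_two]
  exact (contDiffOn_succ_iff_deriv_of_isOpen hJ).2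
    ⟨hdiff, by simp, (hf.comp hone hmaps).congr hderiv⟩

variable [I.Boundaryless]

lemma HasSmoothChristoffel.isGeodesicOn_of_hasDerivAt (hnabla : HasSmoothChristoffel nabla)
    {α : ℝ → E × E} {J : Set ℝ} (hJ : IsOpen J)
    (hα : ∀ t ∈ J, α t ∈ (extChartAt I p).target ×ˢ Set.univ ∧
      HasDerivAt α (geodesicField nabla p (α t)) t) :
    IsGeodesicOn nabla (fun t ↦ (extChartAt I p).symm (α t).1) J := by
  have hα₂ : ContDiffOn ℝ 2 α J :=
    contDiffOn_two_of_hasDerivAt (hnabla.contDiffOn_geodesicField p) hJ hα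
  have hsmooth (t : ℝ) (ht : t ∈ J) :
      ContMDiffAt 𝓘(ℝ) I 2 (fun t ↦ (extChartAt I p).symm (α t).1) t := by
    have hsymm : ContMDiffAt 𝓘(ℝ, E) I 2 (extChartAt I p).symm (α t).1 :=
      ((contMDiffOn_extChartAt_symm p).contMDiffAt
        ((isOpen_extChartAt_target p).mem_nhds (hα t ht).1.1)).of_le
          (show (2 : WithTop ℕ∞) ≤ ∞ from ENat.LEInfty.out)
    exact hsymm.comp t (contDiffAt_fst.comp t (hα₂.contDiffAt (hJ.mem_nhds ht))).contMDiffAt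
  refine ⟨fun t ht ↦ (hsmooth t ht).contMDiffWithinAt, fun t ht ↦ ?_⟩
  have hphase := phaseCurve_extChartAt_symm hJ (fun t ht ↦ (hα t ht).1.1)
    fun t ht ↦ (hα t ht).2.fst
  rw [covDerivAlong_velocity_eq_zero_iff nabla (hsmooth t ht)
    (extChartAt_symm_mem_source (hα t ht).1.1), hphase ht]
  exact (hα t ht).2.congr_of_eventuallyEq (hphase.eventuallyEq_of_mem (hJ.mem_nhds ht))

end GeodesicEquation

section OrdinaryDifferentialEquations

lemma exists_pos_forall_mem_of_isCompact {X : Type*} [TopologicalSpace X] {K : Set X}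
    (hK : IsCompact K) {P : ℝ → X → Prop} (hmono : ∀ ⦃δ ε x⦄, δ ≤ ε → P ε x → P δ x)
    (hlocal : ∀ x ∈ K, ∃ ε > 0, ∀ᶠ y in nhds x, P ε y) : ∃ ε > 0, ∀ x ∈ K, P ε x := by
  refine hK.induction_on (p := fun K ↦ ∃ ε > 0, ∀ x ∈ K, P ε x) ?_ ?_ ?_ ?_
  · exact ⟨1, one_pos, fun x hx ↦ hx.elim⟩
  · rintro s t hst ⟨ε, hε, ht⟩
    exact ⟨ε, hε, fun x hx ↦ ht x (hst hx)⟩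
  · rintro s t ⟨ε, hε, hs⟩ ⟨δ, hδ, ht⟩
    refine ⟨min ε δ, lt_min hε hδ, fun x hx ↦ ?_⟩
    exact hx.elim (fun hxs ↦ hmono (min_le_left _ _) (hs x hxs))
      fun hxt ↦ hmono (min_le_right _ _) (ht x hxt)
  · intro x hx
    obtain ⟨ε, hε, hy⟩ := hlocal x hx
    exact ⟨_, mem_nhdsWithin_of_mem_nhds hy, ε, hε, fun y hy ↦ hy⟩

variable {F : Type*} [NormedAddCommGroup F] [NormedSpace ℝ F] {f : F → F} {Ω : Set F}

lemma eventually_exists_hasDerivAt_mem [CompleteSpace F] {x₀ : F}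
    (hf : ContDiffAt ℝ 1 f x₀) (hΩ : Ω ∈ nhds x₀) :
    ∃ ε > (0 : ℝ), ∀ᶠ x in nhds x₀, ∃ α : ℝ → F, α 0 = x ∧
      ∀ t ∈ Metric.ball 0 ε, α t ∈ Ω ∧ HasDerivAt α (f (α t)) t := by
  obtain ⟨ε, hε, a, r, L, K, hr, hpl⟩ := IsPicardLindelof.of_contDiffAt_one hf
  obtain ⟨α, hα, hcont⟩ := (hpl 0).exists_forall_mem_closedBall_eq_hasDerivWithinAt_continuousOn
  simp only [← Real.closedBall_eq_Icc] at hα hcont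
  have hmem : ∀ᶠ z in nhds x₀ ×ˢ nhds (0 : ℝ), α z ∈ Ω := by
    rw [← nhds_prod_eq]
    refine (hcont.continuousAt (prod_mem_nhds (Metric.closedBall_mem_nhds x₀ hr)
      (Metric.closedBall_mem_nhds 0 hε))).eventually_mem ?_
    rwa [(hα x₀ (Metric.mem_closedBall_self hr.le)).1]
  obtain ⟨u, hu, v, hv, huv⟩ := Filter.eventually_prod_iff.1 hmem
  obtain ⟨δ, hδ, hδv⟩ := Metric.eventually_nhds_iff_ball.1 hv
  refine ⟨min ε δ, lt_min hε hδ, ?_⟩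
  filter_upwards [hu, Metric.closedBall_mem_nhds x₀ hr] with x hx hxr
  refine ⟨fun t ↦ α (x, t), (hα x hxr).1, fun t ht ↦
    ⟨huv hx (hδv t (Metric.ball_subset_ball (min_le_right ε δ) ht)), ?_⟩⟩
  have htε : t ∈ Metric.ball 0 ε := Metric.ball_subset_ball (min_le_left ε δ) ht
  exact ((hα x hxr).2 t (Metric.ball_subset_closedBall htε)).hasDerivAt
    (Filter.mem_of_superset (Metric.isOpen_ball.mem_nhds htε) Metric.ball_subset_closedBall)

lemma exists_pos_forall_mem_exists_hasDerivAt_mem [CompleteSpace F] (hΩ : IsOpen Ω)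
    (hf : ContDiffOn ℝ 1 f Ω) {K : Set F} (hK : IsCompact K) (hKΩ : K ⊆ Ω) :
    ∃ ε > (0 : ℝ), ∀ x ∈ K, ∃ α : ℝ → F, α 0 = x ∧
      ∀ t ∈ Metric.ball 0 ε, α t ∈ Ω ∧ HasDerivAt α (f (α t)) t := by
  refine exists_pos_forall_mem_of_isCompact hK ?_ fun x hx ↦ ?_
  · rintro δ ε x hδ ⟨α, hx, hα⟩
    exact ⟨α, hx, fun t ht ↦ hα t (Metric.ball_subset_ball hδ ht)⟩
  · have hΩx := hΩ.mem_nhds (hKΩ hx)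
    exact eventually_exists_hasDerivAt_mem (hf.contDiffAt hΩx) hΩx

lemma eventuallyEq_of_hasDerivAt {t₀ : ℝ} {α β : ℝ → F} (hf : ContDiffAt ℝ 1 f (α t₀))
    (hα : ∀ᶠ t in nhds t₀, HasDerivAt α (f (α t)) t)
    (hβ : ∀ᶠ t in nhds t₀, HasDerivAt β (f (β t)) t) (h : α t₀ = β t₀) : α =ᶠ[nhds t₀] β := by
  obtain ⟨K, s, hs, hlip⟩ := hf.exists_lipschitzOnWith
  have hαs := hα.self_of_nhds.continuousAt.eventually_mem hs
  have hβs := hβ.self_of_nhds.continuousAt.eventually_mem (h ▸ hs)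
  exact ODE_solution_unique_of_eventually (v := fun _ ↦ f) (s := fun _ ↦ s)
    (.of_forall fun _ ↦ hlip) (hα.and hαs) (hβ.and hβs) h

end OrdinaryDifferentialEquations

section Geodesics

variable {E : Type*} [NormedAddCommGroup E] [NormedSpace ℝ E] [FiniteDimensional ℝ E]
  {H : Type*} [TopologicalSpace H] {I : ModelWithCorners ℝ E H}
  {M : Type*} [TopologicalSpace M] [ChartedSpace H M] [IsManifold I ∞ M]
  {nabla : Connection I M} {γ δ : ℝ → M} {s u : Set ℝ} {t : ℝ} {p : M}

lemma IsGeodesicOn.congr (h : IsGeodesicOn nabla γ s) (hs : IsOpen s) (hδ : Set.EqOn δ γ s) :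
    IsGeodesicOn nabla δ s := by
  refine ⟨h.1.congr hδ, fun t ht ↦ ?_⟩
  have heq : δ =ᶠ[nhds t] γ := hδ.eventuallyEq_of_mem (hs.mem_nhds ht)
  have hphase : phaseCurve I (γ t) δ =ᶠ[nhds t] phaseCurve I (γ t) γ := phaseCurve_congr heq
  have hx := mem_chart_source H (γ t)
  rw [covDerivAlong_velocity_eq_zero_iff nabla ((h.contMDiffAt hs ht).congr_of_eventuallyEq heq)
    (p := γ t) (by rwa [hδ ht]), hphase.self_of_nhds]
  exact (h.hasDerivAt_phaseCurve hs ht hx).congr_of_eventuallyEq hphase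

lemma isGeodesicOn_of_forall_exists
    (h : ∀ t ∈ s, ∃ (δ : ℝ → M) (u : Set ℝ), IsOpen u ∧ t ∈ u ∧ IsGeodesicOn nabla δ u ∧
      Set.EqOn γ δ u) : IsGeodesicOn nabla γ s := by
  refine ⟨fun t ht ↦ ?_, fun t ht ↦ ?_⟩ <;> obtain ⟨δ, u, hu, htu, hδ, heq⟩ := h t ht
  · exact ((hδ.congr hu heq).contMDiffAt hu htu).contMDiffWithinAt
  · exact (hδ.congr hu heq).2 t htu

lemma exists_isGeodesicOn_union (hs : IsOpen s) (hu : IsOpen u) (hγ : IsGeodesicOn nabla γ s)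
    (hδ : IsGeodesicOn nabla δ u) (h : Set.EqOn γ δ (s ∩ u)) :
    ∃ η : ℝ → M, IsGeodesicOn nabla η (s ∪ u) ∧ Set.EqOn η γ s ∧ Set.EqOn η δ u := by
  classical
  have hηγ : Set.EqOn (s.piecewise γ δ) γ s := s.piecewise_eqOn γ δ
  have hηδ : Set.EqOn (s.piecewise γ δ) δ u := fun t ht ↦ by
    by_cases hts : t ∈ s
    · rw [hηγ hts, h ⟨hts, ht⟩]
    · exact s.piecewise_eq_of_notMem γ δ hts
  refine ⟨s.piecewise γ δ, isGeodesicOn_of_forall_exists ?_, hηγ, hηδ⟩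
  rintro t (ht | ht)
  · exact ⟨γ, s, hs, ht, hγ, hηγ⟩
  · exact ⟨δ, u, hu, ht, hδ, hηδ⟩

lemma exists_isGeodesicOn_iUnion [Nonempty M] {ι : Type*} {s : ι → Set ℝ} {γ : ι → ℝ → M}
    (hs : ∀ i, IsOpen (s i)) (hγ : ∀ i, IsGeodesicOn nabla (γ i) (s i))
    (h : ∀ i j, Set.EqOn (γ i) (γ j) (s i ∩ s j)) :
    ∃ δ : ℝ → M, IsGeodesicOn nabla δ (⋃ i, s i) ∧ ∀ i, Set.EqOn δ (γ i) (s i) := by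
  classical
  let δ (t : ℝ) : M := if ht : ∃ i, t ∈ s i then γ ht.choose t else Classical.arbitrary M
  have hδ (i : ι) : Set.EqOn δ (γ i) (s i) := fun t ht ↦ by
    have ht' : ∃ i, t ∈ s i := ⟨i, ht⟩
    simp only [δ, dif_pos ht']
    exact h _ _ ⟨ht'.choose_spec, ht⟩
  refine ⟨δ, isGeodesicOn_of_forall_exists fun t ht ↦ ?_, hδ⟩
  obtain ⟨i, hi⟩ := Set.mem_iUnion.1 ht
  exact ⟨γ i, s i, hs i, hi, hγ i, hδ i⟩

variable [I.Boundaryless]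

lemma HasSmoothChristoffel.eventuallyEq_of_phaseCurve_eq (hnabla : HasSmoothChristoffel nabla)
    (hγ : IsGeodesicOn nabla γ s) (hs : IsOpen s) (ht : t ∈ s) (hγp : γ t ∈ (chartAt H p).source)
    (hδ : IsGeodesicOn nabla δ u) (hu : IsOpen u) (ht' : t ∈ u)
    (hδp : δ t ∈ (chartAt H p).source) (h : phaseCurve I p γ t = phaseCurve I p δ t) :
    γ =ᶠ[nhds t] δ := by
  have hγ_source := (hγ.contMDiffAt hs ht).continuousAt.eventually (chart_source_mem_nhds hγp)
  have hδ_source := (hδ.contMDiffAt hu ht').continuousAt.eventually (chart_source_mem_nhds hδp)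
  have hΩ : ((extChartAt I p).target ×ˢ Set.univ : Set (E × E)) ∈ nhds (phaseCurve I p γ t) :=
    ((isOpen_extChartAt_target p).prod isOpen_univ).mem_nhds
      ⟨extChartAt_mem_target hγp, Set.mem_univ _⟩
  have hphase : phaseCurve I p γ =ᶠ[nhds t] phaseCurve I p δ := by
    refine eventuallyEq_of_hasDerivAt ((hnabla.contDiffOn_geodesicField p).contDiffAt hΩ) ?_ ?_ h
    · filter_upwards [hγ_source, hs.mem_nhds ht] with r hrp hr
        using hγ.hasDerivAt_phaseCurve hs hr hrp
    · filter_upwards [hδ_source, hu.mem_nhds ht'] with r hrp hr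
        using hδ.hasDerivAt_phaseCurve hu hr hrp
  filter_upwards [hphase, hγ_source, hδ_source] with r hr hγr hδr
  have hchart : extChartAt I p (γ r) = extChartAt I p (δ r) := congrArg Prod.fst hr
  rw [← extChartAt_symm_extChartAt (I := I) hγr, hchart, extChartAt_symm_extChartAt hδr]

lemma HasSmoothChristoffel.eventuallyEq_of_frequently [T2Space M]
    (hnabla : HasSmoothChristoffel nabla) (hγ : IsGeodesicOn nabla γ s)
    (hδ : IsGeodesicOn nabla δ s) (hs : IsOpen s) (ht : t ∈ s)
    (h : ∃ᶠ r in nhds t, γ =ᶠ[nhds r] δ) : γ =ᶠ[nhds t] δ := by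
  have hγt := hγ.contMDiffAt hs ht
  have hδt := hδ.contMDiffAt hs ht
  have hpos : γ t = δ t := tendsto_nhds_unique_of_frequently_eq hγt.continuousAt
    hδt.continuousAt (h.mono fun r hr ↦ hr.self_of_nhds)
  have hγp := mem_chart_source H (γ t)
  have hδp : δ t ∈ (chartAt H (γ t)).source := hpos ▸ hγp
  exact hnabla.eventuallyEq_of_phaseCurve_eq hγ hs ht hγp hδ hs ht hδp <|
    tendsto_nhds_unique_of_frequently_eq (differentiableAt_phaseCurve hγt hγp).continuousAt
      (differentiableAt_phaseCurve hδt hδp).continuousAt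
      (h.mono fun r hr ↦ (phaseCurve_congr hr).self_of_nhds)

lemma HasSmoothChristoffel.eqOn_of_eventuallyEq [T2Space M] (hnabla : HasSmoothChristoffel nabla)
    (hγ : IsGeodesicOn nabla γ s) (hδ : IsGeodesicOn nabla δ s) (hs : IsOpen s)
    (hs' : IsPreconnected s) (ht : t ∈ s) (h : γ =ᶠ[nhds t] δ) : Set.EqOn γ δ s := by
  have hsub : s ⊆ {r | γ =ᶠ[nhds r] δ} :=
    hs'.subset_of_closure_inter_subset isOpen_setOfPred_eventually_nhds ⟨t, ht, h⟩
      fun r ⟨hr, hrs⟩ ↦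
        hnabla.eventuallyEq_of_frequently hγ hδ hs hrs (mem_closure_iff_frequently.1 hr)
  exact fun r hr ↦ (hsub hr).self_of_nhds

lemma HasSmoothChristoffel.eqOn_inter [T2Space M] (hnabla : HasSmoothChristoffel nabla)
    (hγ : IsGeodesicOn nabla γ s) (hs : IsOpen s) (hs' : s.OrdConnected)
    (hδ : IsGeodesicOn nabla δ u) (hu : IsOpen u) (hu' : u.OrdConnected) (ht : t ∈ s ∩ u)
    (h : γ =ᶠ[nhds t] δ) : Set.EqOn γ δ (s ∩ u) :=
  hnabla.eqOn_of_eventuallyEq (hγ.mono Set.inter_subset_left) (hδ.mono Set.inter_subset_right)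
    (hs.inter hu) (hs'.inter hu').isPreconnected ht h

/-- `(δ, S)` is a geodesic on an open interval that admits no proper extension. -/
structure IsMaximalGeodesic (nabla : Connection I M) (δ : ℝ → M) (S : Set ℝ) : Prop where
  isOpen : IsOpen S
  ordConnected : S.OrdConnected
  isGeodesicOn : IsGeodesicOn nabla δ S
  subset_of_eqOn : ∀ ⦃u : Set ℝ⦄ ⦃β : ℝ → M⦄, IsOpen u → u.OrdConnected →
    IsGeodesicOn nabla β u → S ⊆ u → Set.EqOn β δ S → u ⊆ S

lemma HasSmoothChristoffel.exists_isMaximalGeodesic [T2Space M]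
    (hnabla : HasSmoothChristoffel nabla) (hγ : IsGeodesicOn nabla γ s) (hs : IsOpen s)
    (hs' : s.OrdConnected) (ht : t ∈ s) :
    ∃ (δ : ℝ → M) (S : Set ℝ), IsMaximalGeodesic nabla δ S ∧ s ⊆ S ∧ Set.EqOn δ γ s := by
  have : Nonempty M := ⟨γ t⟩
  let ι := {q : Set ℝ × (ℝ → M) // IsOpen q.1 ∧ q.1.OrdConnected ∧ IsGeodesicOn nabla q.2 q.1 ∧
    t ∈ q.1 ∧ q.2 =ᶠ[nhds t] γ}
  have hagree (i j : ι) : Set.EqOn i.1.2 j.1.2 (i.1.1 ∩ j.1.1) := by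
    obtain ⟨⟨u, α⟩, hu, hu', hα, htu, hαγ⟩ := i
    obtain ⟨⟨v, β⟩, hv, hv', hβ, htv, hβγ⟩ := j
    exact hnabla.eqOn_inter hα hu hu' hβ hv hv' ⟨htu, htv⟩ (hαγ.trans hβγ.symm)
  obtain ⟨δ, hδ, hδi⟩ := exists_isGeodesicOn_iUnion (fun i : ι ↦ i.2.1) (fun i ↦ i.2.2.2.1) hagree
  have hmem (i : ι) : i.1.1 ⊆ ⋃ i : ι, i.1.1 := Set.subset_iUnion (fun i : ι ↦ i.1.1) i
  let i₀ : ι := ⟨(s, γ), hs, hs', hγ, ht, .rfl⟩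
  have hδγ : Set.EqOn δ γ s := hδi i₀
  refine ⟨δ, ⋃ i : ι, i.1.1, ⟨isOpen_iUnion fun i ↦ i.2.1, ?_, hδ, ?_⟩, hmem i₀, hδγ⟩
  · exact (isPreconnected_iUnion ⟨t, Set.mem_iInter.2 fun i ↦ i.2.2.2.2.1⟩
      fun i ↦ i.2.2.1.isPreconnected).ordConnected
  · intro u β hu hu' hβ hsub hβδ
    have hβγ : Set.EqOn β γ s := (hβδ.mono (hmem i₀)).trans hδγ
    exact hmem ⟨(u, β), hu, hu', hβ, hsub (hmem i₀ ht), hβγ.eventuallyEq_of_mem (hs.mem_nhds ht)⟩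

lemma IsMaximalGeodesic.subset_of_eventuallyEq [T2Space M] {S : Set ℝ} {β : ℝ → M}
    (h : IsMaximalGeodesic nabla δ S) (hnabla : HasSmoothChristoffel nabla)
    (hβ : IsGeodesicOn nabla β u) (hu : IsOpen u) (hu' : u.OrdConnected) (ht : t ∈ S ∩ u)
    (hβδ : β =ᶠ[nhds t] δ) : u ⊆ S := by
  obtain ⟨η, hη, hηδ, -⟩ := exists_isGeodesicOn_union h.isOpen hu h.isGeodesicOn hβ <|
    hnabla.eqOn_inter h.isGeodesicOn h.isOpen h.ordConnected hβ hu hu' ht hβδ.symm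
  have hunion : (S ∪ u).OrdConnected :=
    (h.ordConnected.isPreconnected.union t ht.1 ht.2 hu'.isPreconnected).ordConnected
  exact Set.subset_union_right.trans <|
    h.subset_of_eqOn (h.isOpen.union hu) hunion hη Set.subset_union_left hηδ

lemma IsMaximalGeodesic.eq_univ [T2Space M] {S : Set ℝ} (h : IsMaximalGeodesic nabla δ S)
    (hnabla : HasSmoothChristoffel nabla) (hS : S.Nonempty) {ε : ℝ} (hε : 0 < ε)
    (hext : ∀ t ∈ S, ∃ β, IsGeodesicOn nabla β (Metric.ball t ε) ∧ β =ᶠ[nhds t] δ) :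
    S = Set.univ := by
  have hball (t : ℝ) (ht : t ∈ S) : Metric.ball t ε ⊆ S := by
    obtain ⟨β, hβ, hβδ⟩ := hext t ht
    exact h.subset_of_eventuallyEq hnabla hβ Metric.isOpen_ball
      (Real.ball_eq_Ioo t ε ▸ Set.ordConnected_Ioo) ⟨ht, Metric.mem_ball_self hε⟩ hβδ
  have hclosed : IsClosed S := isClosed_of_closure_subset fun t ht ↦ by
    obtain ⟨r, hr, htr⟩ := Metric.mem_closure_iff.1 ht ε hε
    exact hball r hr htr
  exact IsClopen.eq_univ ⟨hclosed, h.isOpen⟩ hS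

end Geodesics

section Completeness

section

variable {V W X : Type*} [NormedAddCommGroup V] [NormedSpace ℝ V] [NormedAddCommGroup W]
  [NormedSpace ℝ W] [NormedAddCommGroup X] [NormedSpace ℝ X] {u v : ℝ → V} {u' v' : V} {t : ℝ}

lemma hasDerivAt_comp_of_contDiffAt {G : V → X} (hG : ContDiffAt ℝ 1 G (u t))
    (hu : HasDerivAt u u' t) : HasDerivAt (fun r ↦ G (u r)) (fderiv ℝ G (u t) u') t :=
  (hG.differentiableAt one_ne_zero).hasFDerivAt.comp_hasDerivAt t hu

lemma hasDerivAt_bilinear_apply {G : V → V →L[ℝ] V →L[ℝ] W} (hG : ContDiffAt ℝ 1 G (u t))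
    (hu : HasDerivAt u u' t) (hv : HasDerivAt v v' t) :
    HasDerivAt (fun r ↦ G (u r) (v r) (v r))
      (fderiv ℝ G (u t) u' (v t) (v t) + G (u t) v' (v t) + G (u t) (v t) v') t := by
  have hcomp := hasDerivAt_comp_of_contDiffAt hG hu
  have happly := hcomp.clm_apply hv
  exact happly.clm_apply hv

end

variable {E : Type*} [NormedAddCommGroup E] [NormedSpace ℝ E] [FiniteDimensional ℝ E]
  {H : Type*} [TopologicalSpace H] {I : ModelWithCorners ℝ E H} [I.Boundaryless]
  {M : Type*} [TopologicalSpace M] [ChartedSpace H M] [IsManifold I ∞ M]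
  {nabla : Connection I M}

lemma HasSmoothChristoffel.exists_pos_forall_exists_isGeodesicOn_ball
    (hnabla : HasSmoothChristoffel nabla) {p : M} {K : Set (E × E)} (hK : IsCompact K)
    (hKp : K ⊆ (extChartAt I p).target ×ˢ Set.univ) :
    ∃ ε > (0 : ℝ), ∀ z ∈ K, ∀ t, ∃ β : ℝ → M, IsGeodesicOn nabla β (Metric.ball t ε) ∧
      β t ∈ (chartAt H p).source ∧ phaseCurve I p β t = z := by
  have hE : CompleteSpace E := FiniteDimensional.complete ℝ E
  obtain ⟨ε, hε, hode⟩ := exists_pos_forall_mem_exists_hasDerivAt_mem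
    ((isOpen_extChartAt_target p).prod isOpen_univ) (hnabla.contDiffOn_geodesicField p) hK hKp
  refine ⟨ε, hε, fun z hz t ↦ ?_⟩
  obtain ⟨α, hα₀, hα⟩ := hode z hz
  have hshift : ∀ r ∈ Metric.ball t ε, α (r - t) ∈ (extChartAt I p).target ×ˢ Set.univ ∧
      HasDerivAt (fun r ↦ α (r - t)) (geodesicField nabla p (α (r - t))) r := fun r hr ↦ by
    have hr₀ : r - t ∈ Metric.ball 0 ε := by rwa [mem_ball_zero_iff, ← mem_ball_iff_norm]
    exact ⟨(hα _ hr₀).1, (hα _ hr₀).2.comp_sub_const r t⟩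
  have ht : t ∈ Metric.ball t ε := Metric.mem_ball_self hε
  refine ⟨_, hnabla.isGeodesicOn_of_hasDerivAt Metric.isOpen_ball hshift,
    extChartAt_symm_mem_source (hshift t ht).1.1, ?_⟩
  rw [phaseCurve_extChartAt_symm Metric.isOpen_ball (fun r hr ↦ (hshift r hr).1.1)
    (fun r hr ↦ (hshift r hr).2.fst) ht]
  simp only [sub_self, hα₀]

variable [RiemannianBundle (fun x : M ↦ TangentSpace I x)]

/-- Every geodesic through `x` of speed at most `C` extends, as a germ, by time `ε` in both
directions. -/
def GeodesicsExtendBy (nabla : Connection I M) (C ε : ℝ) (x : M) : Prop :=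
  ∀ ⦃γ : ℝ → M⦄ ⦃s : Set ℝ⦄ ⦃t : ℝ⦄, IsGeodesicOn nabla γ s → IsOpen s → t ∈ s → γ t = x →
    ‖velocity I γ t‖ ≤ C → ∃ β, IsGeodesicOn nabla β (Metric.ball t ε) ∧ β =ᶠ[nhds t] γ

variable [IsContMDiffRiemannianBundle I ∞ E (fun x : M ↦ TangentSpace I x)]

omit [FiniteDimensional ℝ E] [I.Boundaryless] in
variable (I) in
lemma exists_eventually_norm_coord_le (p : M) :
    ∃ c > 0, ∀ᶠ x in nhds p, ∀ u : TangentSpace I x, ‖coord I p x u‖ ≤ c * ‖u‖ := by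
  obtain ⟨g, hg, hinner⟩ := IsContMDiffRiemannianBundle.exists_contMDiff (IB := I) (n := ∞) (F := E)
    (E := fun x : M ↦ TangentSpace I x)
  have hcont : IsContinuousRiemannianBundle E (fun x : M ↦ TangentSpace I x) :=
    ⟨g, hg.continuous, hinner⟩
  obtain ⟨c, hc, hlt⟩ :=
    eventually_norm_trivializationAt_lt E (fun x : M ↦ TangentSpace I x) p
  exact ⟨c, hc, hlt.mono fun x hx u ↦ (coord I p x).le_of_opNorm_le hx.le u⟩

lemma HasSmoothChristoffel.exists_pos_eventually_geodesicsExtendBy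
    (hnabla : HasSmoothChristoffel nabla) (C : ℝ) (p : M) :
    ∃ ε > 0, ∀ᶠ x in nhds p, GeodesicsExtendBy nabla C ε x := by
  obtain ⟨c, hc, hcoord⟩ := exists_eventually_norm_coord_le I p
  obtain ⟨r, hr, hball⟩ := Metric.nhds_basis_closedBall.mem_iff.1
    ((isOpen_extChartAt_target (I := I) p).mem_nhds (mem_extChartAt_target p))
  obtain ⟨ε, hε, hgeod⟩ := hnabla.exists_pos_forall_exists_isGeodesicOn_ball
    ((isCompact_closedBall (extChartAt I p p) r).prod (isCompact_closedBall (0 : E) (c * C)))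
    (Set.prod_mono hball (Set.subset_univ _))
  refine ⟨ε, hε, ?_⟩
  filter_upwards [hcoord, chart_source_mem_nhds (mem_chart_source H p),
    (continuousAt_extChartAt (I := I) p).eventually (Metric.closedBall_mem_nhds _ hr)]
    with x hxc hxp hxr γ s t hγ hs ht hγx hC
  subst hγx
  have hvel := coord_velocity hxp ((hγ.contMDiffAt hs ht).mdifferentiableAt (by simp))
  have hphase : phaseCurve I p γ t ∈
      Metric.closedBall (extChartAt I p p) r ×ˢ Metric.closedBall 0 (c * C) := by
    refine ⟨hxr, mem_closedBall_zero_iff.2 ?_⟩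
    rw [phaseCurve, ← hvel]
    exact (hxc _).trans (mul_le_mul_of_nonneg_left hC hc.le)
  obtain ⟨β, hβ, hβp, hβphase⟩ := hgeod _ hphase t
  exact ⟨β, hβ, hnabla.eventuallyEq_of_phaseCurve_eq hβ Metric.isOpen_ball
    (Metric.mem_ball_self hε) hβp hγ hs ht hxp hβphase⟩

lemma HasSmoothChristoffel.exists_pos_forall_geodesicsExtendBy [CompactSpace M]
    (hnabla : HasSmoothChristoffel nabla) (C : ℝ) :
    ∃ ε > 0, ∀ x, GeodesicsExtendBy nabla C ε x := by
  obtain ⟨ε, hε, hext⟩ := exists_pos_forall_mem_of_isCompact isCompact_univ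
    (P := GeodesicsExtendBy nabla C)
    (fun δ ε x hδ h γ s t hγ hs ht hx hC ↦ by
      obtain ⟨β, hβ, hβγ⟩ := h hγ hs ht hx hC
      exact ⟨β, hβ.mono (Metric.ball_subset_ball hδ), hβγ⟩)
    (fun p _ ↦ hnabla.exists_pos_eventually_geodesicsExtendBy C p)
  exact ⟨ε, hε, fun x ↦ hext x (Set.mem_univ x)⟩

theorem HasSmoothChristoffel.isComplete_of_forall_norm_velocity_le [T2Space M] [CompactSpace M]
    (hnabla : HasSmoothChristoffel nabla)
    (hspeed : ∀ (γ : ℝ → M) (s : Set ℝ), IsGeodesicOn nabla γ s → IsOpen s → IsPreconnected s →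
      ∃ C, ∀ t ∈ s, ‖velocity I γ t‖ ≤ C) : IsComplete nabla := by
  rintro s γ hs hs' ⟨t, ht⟩ hγ
  obtain ⟨δ, S, hmax, hsS, hδγ⟩ := hnabla.exists_isMaximalGeodesic hγ hs hs' ht
  obtain ⟨C, hC⟩ := hspeed δ S hmax.isGeodesicOn hmax.isOpen hmax.ordConnected.isPreconnected
  obtain ⟨ε, hε, hext⟩ := hnabla.exists_pos_forall_geodesicsExtendBy C
  have hS : S = Set.univ := hmax.eq_univ hnabla ⟨t, hsS ht⟩ hε fun r hr ↦
    hext (δ r) hmax.isGeodesicOn hmax.isOpen hr rfl (hC r hr)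
  exact ⟨δ, hS ▸ hmax.isGeodesicOn, hδγ⟩

variable {γ : ℝ → M} {s : Set ℝ} {t : ℝ}

lemma IsGeodesicOn.hasDerivAt_inner_velocity (hγ : IsGeodesicOn nabla γ s) (hs : IsOpen s)
    (ht : t ∈ s) :
    HasDerivAt (fun r ↦ (inner ℝ (velocity I γ r) (velocity I γ r) : ℝ))
      (nablaMetric nabla (γ t) (velocity I γ t) (velocity I γ t) (velocity I γ t)) t := by
  let p := γ t
  have hx : γ t ∈ (chartAt H p).source := mem_chart_source H _
  have hγt := hγ.contMDiffAt hs ht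
  have hgeod := hγ.hasDerivAt_phaseCurve hs ht hx
  have hG : ContDiffAt ℝ 1 (metricCoord I p) (extChartAt I p (γ t)) :=
    ((contDiffOn_metricCoord p).contDiffAt ((isOpen_extChartAt_target p).mem_nhds
      (extChartAt_mem_target hx))).of_le (by exact_mod_cast le_top)
  have hcoord : (fun r ↦ (inner ℝ (velocity I γ r) (velocity I γ r) : ℝ)) =ᶠ[nhds t] fun r ↦
      metricCoord I p (phaseCurve I p γ r).1 (phaseCurve I p γ r).2 (phaseCurve I p γ r).2 := by
    filter_upwards [coord_velocity_eventuallyEq hγt hx,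
      hγt.continuousAt.eventually (chart_source_mem_nhds hx)] with r hvel hr
    rw [inner_eq_metricCoord hr, hvel]
    rfl
  refine ((hasDerivAt_bilinear_apply hG hgeod.fst hgeod.snd).congr_of_eventuallyEq
    hcoord).congr_deriv ?_
  rw [nablaMetric_eq nabla hx, coord_velocity hx (hγt.mdifferentiableAt (by simp)),
    ← fderiv_bilinear_apply (hG.differentiableAt one_ne_zero)]
  simp only [geodesicField, phaseCurve, map_neg, neg_apply]
  ring

variable {σ : M → ℝ}

lemma IsGeodesicOn.hasDerivAt_exp_mul_inner_velocity (hσ : CMDiff 1 σ)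
    (h : ∀ (x : M) (u : TangentSpace I x),
      nablaMetric nabla x u u u = -2 * (d% σ x u * inner ℝ u u))
    (hγ : IsGeodesicOn nabla γ s) (hs : IsOpen s) (ht : t ∈ s) :
    HasDerivAt (fun r ↦ Real.exp (2 * σ (γ r)) * inner ℝ (velocity I γ r) (velocity I γ r))
      0 t := by
  have hinner := hγ.hasDerivAt_inner_velocity hs ht
  have hσγ : HasDerivAt (fun r ↦ σ (γ r)) (d% σ (γ t) (velocity I γ t)) t :=
    hasDerivAt_comp_curve (hσ.mdifferentiable one_ne_zero _)
      ((hγ.contMDiffAt hs ht).mdifferentiableAt (by simp))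
  refine ((hσγ.const_mul 2).exp.mul hinner).congr_deriv ?_
  rw [h]
  ring

lemma IsGeodesicOn.exists_forall_norm_velocity_le [CompactSpace M] (hσ : CMDiff 1 σ)
    (h : ∀ (x : M) (u : TangentSpace I x),
      nablaMetric nabla x u u u = -2 * (d% σ x u * inner ℝ u u))
    (hγ : IsGeodesicOn nabla γ s) (hs : IsOpen s) (hs' : IsPreconnected s) :
    ∃ C, ∀ t ∈ s, ‖velocity I γ t‖ ≤ C := by
  obtain rfl | ⟨t₀, ht₀⟩ := s.eq_empty_or_nonempty
  · exact ⟨0, fun t ht ↦ ht.elim⟩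
  obtain ⟨m, hm⟩ := (isCompact_range hσ.continuous).bddBelow
  let energy (r : ℝ) : ℝ := Real.exp (2 * σ (γ r)) * inner ℝ (velocity I γ r) (velocity I γ r)
  have henergy (t : ℝ) (ht : t ∈ s) : HasDerivAt energy 0 t :=
    hγ.hasDerivAt_exp_mul_inner_velocity hσ h hs ht
  refine ⟨√(Real.exp (-(2 * m)) * energy t₀), fun t ht ↦ ?_⟩
  have hconst : energy t₀ = energy t := hs.is_const_of_deriv_eq_zero hs'
    (fun r hr ↦ (henergy r hr).differentiableAt.differentiableWithinAt)
    (fun r hr ↦ (henergy r hr).deriv) ht₀ ht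
  have hmt : m ≤ σ (γ t) := hm ⟨γ t, rfl⟩
  rw [hconst, ← mul_assoc, ← Real.exp_add, real_inner_self_eq_norm_sq]
  exact Real.le_sqrt_of_sq_le <|
    le_mul_of_one_le_left (sq_nonneg _) (Real.one_le_exp (by linarith))

theorem HasSmoothChristoffel.isComplete_of_nablaMetric_self [T2Space M] [CompactSpace M]
    (hnabla : HasSmoothChristoffel nabla) (hσ : CMDiff 1 σ)
    (h : ∀ (x : M) (u : TangentSpace I x),
      nablaMetric nabla x u u u = -2 * (d% σ x u * inner ℝ u u)) : IsComplete nabla :=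
  hnabla.isComplete_of_forall_norm_velocity_le fun _ _ hγ hs hs' ↦
    hγ.exists_forall_norm_velocity_le hσ h hs hs'

end Completeness

section SymDerivMetric

variable {E : Type*} [NormedAddCommGroup E] [NormedSpace ℝ E] [FiniteDimensional ℝ E]
  {H : Type*} [TopologicalSpace H] {I : ModelWithCorners ℝ E H} [I.Boundaryless]
  {M : Type*} [TopologicalSpace M] [ChartedSpace H M] [IsManifold I ∞ M]
  [RiemannianBundle (fun x : M ↦ TangentSpace I x)]
  [IsContMDiffRiemannianBundle I ∞ E (fun x : M ↦ TangentSpace I x)]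
  {nabla : Connection I M} {σ : M → ℝ}

theorem HasCubicForm.isComplete [T2Space M] [CompactSpace M]
    (h : HasCubicForm nabla (symDerivMetric σ)) (hσ : CMDiff ∞ σ) : IsComplete nabla :=
  (h.hasSmoothChristoffel (symDerivMetric_swap₁₂ σ) (symDerivMetric_swap₂₃ σ)
    (hasSmoothComponents_symDerivMetric hσ)).isComplete_of_nablaMetric_self
      (hσ.of_le (by exact_mod_cast le_top)) fun x u ↦ by
        rw [h.nablaMetric_eq (symDerivMetric_swap₂₃ σ), symDerivMetric_self]

end SymDerivMetric

end StatisticalManifold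

end

theorem corollary4p6 {E : Type*} [NormedAddCommGroup E] [NormedSpace ℝ E] [FiniteDimensional ℝ E]
    {H : Type*} [TopologicalSpace H] (I : ModelWithCorners ℝ E H) [I.Boundaryless]
    {M : Type*} [TopologicalSpace M] [ChartedSpace H M] [IsManifold I ∞ M]
    [T2Space M] [CompactSpace M]
    [RiemannianBundle (fun x : M ↦ TangentSpace I x)]
    [IsContMDiffRiemannianBundle I ∞ E (fun x : M ↦ TangentSpace I x)]
    (σ : M → ℝ) (hσ : ContMDiff I 𝓘(ℝ) ∞ σ) :
    (∃ nabla : StatisticalManifold.Connection I M,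
      StatisticalManifold.HasCubicForm nabla (StatisticalManifold.symDerivMetric σ)) ∧
    ∀ nabla : StatisticalManifold.Connection I M,
      StatisticalManifold.HasCubicForm nabla (StatisticalManifold.symDerivMetric σ) →
        StatisticalManifold.IsStatistical nabla ∧
        StatisticalManifold.IsComplete nabla ∧
        (∃ nabla', StatisticalManifold.IsDual nabla nabla') ∧
        ∀ nabla', StatisticalManifold.IsDual nabla nabla' →
          StatisticalManifold.IsComplete nabla' := by
  have hA₂₃ := StatisticalManifold.symDerivMetric_swap₂₃ (I := I) σ
  refine ⟨StatisticalManifold.exists_hasCubicForm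
    (StatisticalManifold.exists_inner_eq_symDerivMetric σ), fun nabla h ↦ ⟨?_, ?_, ?_, ?_⟩⟩
  · exact h.isStatistical (StatisticalManifold.symDerivMetric_swap₁₂ σ) hA₂₃
      (StatisticalManifold.hasSmoothComponents_symDerivMetric hσ)
  · exact h.isComplete hσ
  · exact h.exists_isDual hA₂₃
  · intro nabla' hdual
    have hneg := h.dual hA₂₃ hdual
    rw [← StatisticalManifold.symDerivMetric_neg] at hneg
    exact hneg.isComplete hσ.neg
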